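/- **Setting.** Let $x\in\{0,1\}^n$ be an input and let $U=U_T\cdots U_1$ be a circuit on $N=n+r\ge 1$ qubits, started in $|z\rangle=|x,0^r\rangle$, whose first qubit is the output qubit. Assume the regular form: $T=(T_2+1)L-1$ with $L\ge 5$; the controlled-$Z$ gates are exactly the gates at the times $L,2L,\dots,T_2L$; the controlled-$Z$ gate at time $lL$, on the distinct qubits $f,s$, is surrounded by Pauli gates $Z_f,Z_s$ at the times $lL-2,lL-1$ and $Z_f,Z_s$ at the times $lL+1,lL+2$; all remaining gates are arbitrary single-qubit unitaries. For $M>L$ let $V=V_{T+M}\cdots V_1$ be the idled circuit, $V_t=I$ for $t\le M$ and $V_t=U_{t-M}$ for $t>M$. Let $\mathcal T_2=\{lL+M:1\le l\le T_2\}$ and $\mathcal T_1=\{1,\dots,T+M\}\setminus\mathcal T_2$. Add $T+M$ clock qubits, let $|\hat t\rangle=|1^t0^{T+M-t}\rangle$ for $0\le t\le T+M$, and index a clock operator by the clock qubits it acts on. Set $$H=J_{\rm in}H_{\rm in}+J_{\rm clock}H_{\rm clock}+J_1H_{\rm prop1}+J_2H_{\rm prop2}+(T+M)H_{\rm out},$$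 $$H_{\rm in}=\sum_{i=1}^{N}|\bar z_i\rangle\langle\bar z_i|_i\otimes|0\rangle\langle0|_1,\qquad H_{\rm out}=|0\rangle\langle 0|_{\rm out}\otimes|1\rangle\langle1|_{T+M},\qquad H_{\rm clock}=\sum_{j=1}^{T+M-1}|01\rangle\langle01|_{j,j+1},$$ $$H_{\rm prop1}=\sum_{t\in\mathcal T_1}\tfrac12\big(|10\rangle\langle10|_{t,t+1}+|10\rangle\langle10|_{t-1,t}-V_t\otimes|1\rangle\langle0|_t-V_t^\dagger\otimes|0\rangle\langle1|_t\big),$$ where for $t=1$ the second projector is replaced by $|0\rangle\langle0|_1$ and for $t=T+M$ the first one by $|1\rangle\langle 1|_{T+M}$, and $H_{\rm prop2}=\sum_{t\in\mathcal T_2}(H_{{\rm qubit},t}+H_{{\rm time},t})$, where, with $f,s$ the qubits of the controlled-$Z$ gate at time $t$, $X_j=|1\rangle\langle0|_j+|0\rangle\langle1|_j$, $P_j=|10\rangle\langle10|_{j,j+1}$ and $Y_j=|11\rangle\langle00|_{j,j+1}+|00\rangle\langle11|_{j,j+1}$, $$H_{{\rm qubit},t}=\tfrac12\big(-2|0\rangle\langle0|_f-2|0\rangle\langle0|_s+|1\rangle\langle1|_f+|1\rangle\langle1|_s\big)\otimes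 X_t,$$ $$H_{{\rm time},t}=\tfrac18\big(P_t+6P_{t+1}+P_{t+2}+2Y_{t+1}+X_{t+1}+X_{t+2}+P_{t-3}+6P_{t-2}+P_{t-1}+2Y_{t-2}+X_{t-2}+X_{t-1}\big).$$ The history state and the guiding state are $$|\eta\rangle=\frac1{\sqrt{T+M+1}}\sum_{t=0}^{T+M}V_t\cdots V_1|z\rangle\otimes|\hat t\rangle,\qquad |u\rangle=\frac1{\sqrt{M+1}}\sum_{t=0}^{M}|z\rangle\otimes|\hat t\rangle .$$ A *ground state* is a unit eigenvector for the smallest eigenvalue. A state is *semi-classical with support $s$* if it is the uniform superposition of a non-empty set of at most $s$ computational basis states. **Statement.** There are fixed real polynomials $p_{\rm clock},p_1,p_2,p_{\rm in}$ of one variable such that the following two statements hold. 1. For every instance as above (with no assumption on the acceptance probability of $U$ on $x$, so in the YES and in the NO case), all real $J_{\rm in},J_{\rm clock},J_1,J_2$ and every real $\Delta>0$ with $$J_{\rm clock}\ge p_{\rm clock}\big(\|H_{\rm out}+J_{\rm in}H_{\rm in}+J_2H_{\rm prop2}+J_1H_{\rm prop1}\|\big)\Delta,\qquad J_1\ge p_1\big(\|H_{\rm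 out}+J_{\rm in}H_{\rm in}+J_2H_{\rm prop2}\|\,M\big)\Delta,$$ $$J_2\ge p_2\big(\|H_{\rm out}+J_{\rm in}H_{\rm in}\|\,T\big)\Delta,\qquad J_{\rm in}\ge p_{\rm in}\big(\|H_{\rm out}\|(T+M)\big)\Delta,$$ the operator $H$ is a 2-local Hamiltonian, $|u\rangle$ is semi-classical with support $M+1$, and every ground state $|\phi\rangle$ of $H$ satisfies $$|\langle\phi|\eta\rangle|^2\ge1-\frac1\Delta\qquad\text{and}\qquad|\langle\phi|u\rangle|^2\ge1-\Big(\sqrt{T/M}+\sqrt{1/\Delta}\Big)^2 .$$ 2. For all polynomials $\sigma,q$ with natural coefficients there are polynomials $M,\Delta,B,J_{\rm in},J_{\rm clock},J_1,J_2$ in $n$ with natural coefficients such that for every $n$ with $q(n)>0$ and every instance with $n+r\le\sigma(n)$ and $T\le\sigma(n)$, the choice of $M(n),\Delta(n)$ and of the coefficients $J(n)$ satisfies $M>L$, $\Delta>0$ and all the conditions in 1, and moreover $\|H\|\le B(n)$, $|u\rangle$ is semi-classical with support $B(n)$, and every ground state $|\phi\rangle$ of $H$ satisfies $|\langle\phi|\eta\rangle|^2\ge1-1/\Delta(n)$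 and $|\langle\phi|u\rangle|^2\ge1-1/q(n)$. -/

import Mathlib

open scoped BigOperators

noncomputable section

/-! ### Qubits, operators and states -/

/-- Operators on the qubits labelled by `Q`, as matrices in the computational basis `Q → Bool`
(`false` is `|0⟩` and `true` is `|1⟩`). -/
abbrev QOp (Q : Type) : Type := Matrix (Q → Bool) (Q → Bool) ℂ

/-- Pure state vectors on the qubits labelled by `Q`. -/
abbrev QState (Q : Type) : Type := EuclideanSpace ℂ (Q → Bool)

section Operators

variable {Q : Type} [Fintype Q] [DecidableEq Q]

/-- The operator `A` acting on qubit `q`, tensored with the identity on all other qubits. -/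
def onQubit (q : Q) (A : Matrix Bool Bool ℂ) : QOp Q :=
  Matrix.of fun a b => if ∀ r, r ≠ q → a r = b r then A (a q) (b q) else 0

/-- The operator `|a⟩⟨b|` on qubit `q`, tensored with the identity on all other qubits. -/
def ketbra (q : Q) (a b : Bool) : QOp Q := onQubit q (Matrix.single a b 1)

/-- The Pauli matrix `Z`. -/
def pauliZ : Matrix Bool Bool ℂ := Matrix.diagonal fun b => if b then -1 else 1

/-- The controlled-`Z` gate on the qubits `f` and `s`, tensored with the identity. -/
def czOp (f s : Q) : QOp Q := Matrix.diagonal fun a => if a f && a s then -1 else 1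

/-- The operator norm (with respect to the Euclidean norm on state vectors). -/
def opNorm (A : QOp Q) : ℝ := ‖Matrix.toEuclideanCLM (𝕜 := ℂ) A‖

/-- `A` acts on a state vector. -/
def applyOp (A : QOp Q) (ψ : QState Q) : QState Q := Matrix.toEuclideanLin A ψ

/-- `A` acts only on the qubits in `S`, i.e. `A = B ⊗ I` with `B` an operator on those qubits. -/
def ActsOn (S : Finset Q) (A : QOp Q) : Prop :=
  ∃ B : QOp S, ∀ a b : Q → Bool,
    A a b = if ∀ q, q ∉ S → a q = b q then B (fun q => a q) (fun q => b q) else 0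

/-- A `k`-local Hamiltonian: a sum of Hermitian terms, each acting on at most `k` qubits. -/
def IsLocalHamiltonian (k : ℕ) (H : QOp Q) : Prop :=
  ∃ (m : ℕ) (h : Fin m → QOp Q),
    (∀ i, (h i).IsHermitian ∧ ∃ S : Finset Q, S.card ≤ k ∧ ActsOn S (h i)) ∧ H = ∑ i, h i

/-- `φ` is a ground state of `H`: a unit eigenvector for the smallest eigenvalue. -/
def IsGroundState (H : QOp Q) (φ : QState Q) : Prop :=
  ‖φ‖ = 1 ∧ ∃ E : ℝ, applyOp H φ = (E : ℂ) • φ ∧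
    ∀ E' : ℝ, Module.End.HasEigenvalue (Matrix.toEuclideanLin H) (E' : ℂ) → E ≤ E'

/-- The computational basis state `|a⟩`. -/
def ket (a : Q → Bool) : QState Q := EuclideanSpace.single a 1

/-- The fidelity `|⟨φ|ψ⟩|²` of two pure states. -/
def fidelity (φ ψ : QState Q) : ℝ := ‖inner ℂ φ ψ‖ ^ 2

/-- A uniform superposition of the basis states in a non-empty set of size at most `s`. -/
def IsSemiClassical (s : ℕ) (ψ : QState Q) : Prop :=
  ∃ S : Finset (Q → Bool), S.Nonempty ∧ S.card ≤ s ∧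
    ψ = ((1 / Real.sqrt S.card : ℝ) : ℂ) • ∑ a ∈ S, ket a

end Operators

/-! ### Circuits -/

/-- A gate on `N` qubits: a single-qubit unitary or a controlled-`Z`. -/
inductive Gate (N : ℕ) : Type
  | one (q : Fin N) (u : Matrix.unitaryGroup Bool ℂ) : Gate N
  | cz (f s : Fin N) (hfs : f ≠ s) : Gate N

/-- The gate is a Pauli `Z` on qubit `q`. -/
def Gate.IsZ {N : ℕ} (g : Gate N) (q : Fin N) : Prop :=
  ∃ u : Matrix.unitaryGroup Bool ℂ, g = Gate.one q u ∧ (u : Matrix Bool Bool ℂ) = pauliZ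

/-- A circuit `U_T ⋯ U_1` on `N` qubits with `T = (T₂ + 1) L - 1` gates (`gate t` is `U_t`, for
`1 ≤ t ≤ T`). The controlled-`Z` gates are exactly those at the times `L, 2L, …, T₂ L`;
each one is preceded and followed by a `Z` on each of its two qubits. All other gates are
single-qubit gates. The requirement `5 ≤ L` makes room for these `Z` gates. -/
structure RegularCircuit (N : ℕ) where
  L : ℕ
  T₂ : ℕ
  gate : ℕ → Gate N
  five_le_L : 5 ≤ L
  gate_cz : ∀ l, 1 ≤ l → l ≤ T₂ → ∃ (f s : Fin N) (hfs : f ≠ s),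
    gate (l * L) = Gate.cz f s hfs ∧
    (gate (l * L - 2)).IsZ f ∧ (gate (l * L - 1)).IsZ s ∧
    (gate (l * L + 1)).IsZ f ∧ (gate (l * L + 2)).IsZ s
  gate_one : ∀ t, 1 ≤ t → t ≤ (T₂ + 1) * L - 1 → (∀ l, 1 ≤ l → l ≤ T₂ → t ≠ l * L) →
    ∃ (q : Fin N) (u : Matrix.unitaryGroup Bool ℂ), gate t = Gate.one q u

/-- The number of gates of the circuit. -/
def RegularCircuit.T {N : ℕ} (C : RegularCircuit N) : ℕ := (C.T₂ + 1) * C.L - 1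

/-! ### The Hamiltonian

There are `N` register qubits and `K` clock qubits, the latter numbered `1, …, K`. -/

/-- The qubits: `N` register qubits and `K` clock qubits. -/
abbrev Qubits (N K : ℕ) : Type := Fin N ⊕ Fin K

/-- A gate as an operator on register and clock. -/
def Gate.op {N : ℕ} (K : ℕ) : Gate N → QOp (Qubits N K)
  | Gate.one q u => onQubit (Sum.inl q) (u : Matrix Bool Bool ℂ)
  | Gate.cz f s _ => czOp (Sum.inl f) (Sum.inl s)

/-- `|a⟩⟨b|` on clock qubit number `t`, for `1 ≤ t ≤ K` (no other `t` is ever used). -/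
def clockKB (N K : ℕ) (t : ℕ) (a b : Bool) : QOp (Qubits N K) :=
  if h : 1 ≤ t ∧ t ≤ K then ketbra (Sum.inr ⟨t - 1, by omega⟩) a b else 0

/-- `|10⟩⟨10|` on the clock qubits number `t, t + 1`. -/
def clock10 (N K : ℕ) (t : ℕ) : QOp (Qubits N K) :=
  clockKB N K t true true * clockKB N K (t + 1) false false

/-- `|1⟩⟨0| + |0⟩⟨1|` on clock qubit number `t`. -/
def clockX (N K : ℕ) (t : ℕ) : QOp (Qubits N K) :=
  clockKB N K t true false + clockKB N K t false true

/-- `|11⟩⟨00| + |00⟩⟨11|` on the clock qubits number `t, t + 1`. -/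
def clockXX (N K : ℕ) (t : ℕ) : QOp (Qubits N K) :=
  clockKB N K t true false * clockKB N K (t + 1) true false +
    clockKB N K t false true * clockKB N K (t + 1) false true

/-- Input term: the register must be in state `|z⟩` at time `0`. -/
def HIn {N : ℕ} (K : ℕ) (z : Fin N → Bool) : QOp (Qubits N K) :=
  ∑ i : Fin N, ketbra (Sum.inl i) (!(z i)) (!(z i)) * clockKB N K 1 false false

/-- Output term: the output qubit must be in state `|1⟩` at the final time. -/
def HOut {N : ℕ} (K : ℕ) (out : Fin N) : QOp (Qubits N K) :=
  ketbra (Sum.inl out) false false * clockKB N K K true true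

/-- Clock term: penalizes `01` on neighbouring clock qubits. -/
def HClock (N K : ℕ) : QOp (Qubits N K) :=
  ∑ j ∈ Finset.Icc 1 (K - 1), clockKB N K j false false * clockKB N K (j + 1) true true

namespace RegularCircuit

variable {N : ℕ} (C : RegularCircuit N) (M : ℕ)

/-- The gate applied at time `t` by the circuit `V` that first applies `M` identity gates. -/
def idled (K : ℕ) (t : ℕ) : QOp (Qubits N K) :=
  if t ≤ M then 1 else (C.gate (t - M)).op K

/-- The propagation term for the single-qubit gate at time `t`. -/
def HPropAt (t : ℕ) : QOp (Qubits N (C.T + M)) :=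
  let K := C.T + M
  (1 / 2 : ℂ) •
    ((if t = K then clockKB N K K true true else clock10 N K t) +
      (if t = 1 then clockKB N K 1 false false else clock10 N K (t - 1)) -
      C.idled M K t * clockKB N K t true false -
      (C.idled M K t).conjTranspose * clockKB N K t false true)

/-- The times of the controlled-`Z` gates in the idled circuit. -/
def czTimes : Finset ℕ := (Finset.Icc 1 C.T₂).image fun l => l * C.L + M

/-- The sum of the propagation terms over all times of single-qubit gates. -/
def HProp1 : QOp (Qubits N (C.T + M)) :=
  ∑ t ∈ Finset.Icc 1 (C.T + M) \ C.czTimes M, C.HPropAt M t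

/-- The term acting on a clock qubit and on one of the two qubits of a controlled-`Z` gate. -/
def HQubitAt (t : ℕ) : QOp (Qubits N (C.T + M)) :=
  let K := C.T + M
  match C.gate (t - M) with
  | Gate.one _ _ => 0
  | Gate.cz f s _ =>
      (1 / 2 : ℂ) •
        ((-2 : ℂ) • ketbra (Sum.inl f) false false + (-2 : ℂ) • ketbra (Sum.inl s) false false +
          ketbra (Sum.inl f) true true + ketbra (Sum.inl s) true true) * clockX N K t

/-- The term acting on the clock qubits around the time `t` of a controlled-`Z` gate. -/
def HTimeAt (t : ℕ) : QOp (Qubits N (C.T + M)) :=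
  let K := C.T + M
  (1 / 8 : ℂ) •
    (clock10 N K t + (6 : ℂ) • clock10 N K (t + 1) + clock10 N K (t + 2) +
      (2 : ℂ) • clockXX N K (t + 1) + clockX N K (t + 1) + clockX N K (t + 2) +
      clock10 N K (t - 3) + (6 : ℂ) • clock10 N K (t - 2) + clock10 N K (t - 1) +
      (2 : ℂ) • clockXX N K (t - 2) + clockX N K (t - 2) + clockX N K (t - 1))

/-- The sum of the propagation terms over all times of controlled-`Z` gates. -/
def HProp2 : QOp (Qubits N (C.T + M)) :=
  ∑ t ∈ C.czTimes M, (C.HQubitAt M t + C.HTimeAt M t)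

end RegularCircuit

/-- The coefficients of the terms of the Hamiltonian. -/
structure Couplings where
  Jin : ℝ
  Jclock : ℝ
  J1 : ℝ
  J2 : ℝ

namespace RegularCircuit

variable {N : ℕ} (C : RegularCircuit N) (M : ℕ)

/-- The Hamiltonian
`J_in H_in + J_clock H_clock + J₁ H_prop1 + J₂ H_prop2 + (T + M) H_out`. -/
def hamiltonian (z : Fin N → Bool) (out : Fin N) (J : Couplings) : QOp (Qubits N (C.T + M)) :=
  J.Jin • HIn (C.T + M) z + J.Jclock • HClock N (C.T + M) + J.J1 • C.HProp1 M +
    J.J2 • C.HProp2 M + ((C.T + M : ℕ) : ℝ) • HOut (C.T + M) out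

/-- The conditions on the coefficients, relative to the four given polynomials. -/
def CouplingConditions (pclock p1 p2 pin : Polynomial ℝ) (z : Fin N → Bool) (out : Fin N)
    (J : Couplings) (Δ : ℝ) : Prop :=
  pclock.eval (opNorm (HOut (C.T + M) out + J.Jin • HIn (C.T + M) z + J.J2 • C.HProp2 M +
      J.J1 • C.HProp1 M)) * Δ ≤ J.Jclock ∧
  p1.eval (opNorm (HOut (C.T + M) out + J.Jin • HIn (C.T + M) z + J.J2 • C.HProp2 M) * M) * Δ
      ≤ J.J1 ∧
  p2.eval (opNorm (HOut (C.T + M) out + J.Jin • HIn (C.T + M) z) * C.T) * Δ ≤ J.J2 ∧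
  pin.eval (opNorm (HOut (C.T + M) out) * ((C.T + M : ℕ) : ℝ)) * Δ ≤ J.Jin

/-- The basis state `|z⟩ ⊗ |t̂⟩` with the unary clock state `t̂ = 1⋯10⋯0` (`t` ones). -/
def clocked (z : Fin N → Bool) (t : ℕ) : QState (Qubits N (C.T + M)) :=
  ket (Sum.elim z fun j => decide ((j : ℕ) < t))

/-- The product `V_t ⋯ V_1` of the first `t` gates of the idled circuit. -/
def firstGates : ℕ → QOp (Qubits N (C.T + M))
  | 0 => 1
  | t + 1 => C.idled M (C.T + M) (t + 1) * firstGates t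

/-- The history state
`(T + M + 1)^(-1/2) ∑_{t = 0}^{T + M} V_t ⋯ V_1 |z⟩ ⊗ |t̂⟩`. -/
def history (z : Fin N → Bool) : QState (Qubits N (C.T + M)) :=
  ((1 / Real.sqrt ((C.T + M + 1 : ℕ) : ℝ) : ℝ) : ℂ) •
    ∑ t ∈ Finset.range (C.T + M + 1), applyOp (C.firstGates M t) (C.clocked M z t)

/-- The guiding state `|z⟩ ⊗ (M + 1)^(-1/2) ∑_{t = 0}^{M} |t̂⟩`. -/
def guiding (z : Fin N → Bool) : QState (Qubits N (C.T + M)) :=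
  ((1 / Real.sqrt ((M + 1 : ℕ) : ℝ) : ℝ) : ℂ) •
    ∑ t ∈ Finset.range (M + 1), C.clocked M z t

end RegularCircuit

/-- The initial register state: the input `x` followed by `r` zeros. -/
def initial {n : ℕ} (r : ℕ) (x : Fin n → Bool) : Fin (n + r) → Bool :=
  Fin.append x fun _ => false

end

set_option linter.unusedSectionVars false

noncomputable section

/-! ### Operator norms and energies -/

section Energy

variable {Q : Type} [Fintype Q] [DecidableEq Q]

/-! The penalties are removed one at a time, from the strongest coupling to the weakest: illegal
clock strings (`exists_legal_near`), wrong propagation at single-qubit gates (`exists_near_HProp1`),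
wrong propagation at controlled-Z gates (`exists_near_HProp2`), wrong input (`exists_near_HIn`). The
zero-penalty subspaces are nested and end in the line spanned by the history state. Each lemma
bounds the squared distance to the next subspace by a constant times one penalty energy, for states
already in the previous subspace. The restriction matters for `HProp2`, which need not be
nonnegative: only on states that pass the surrounding Pauli gates correctly does it become a
weighted sum of squared propagation defects (`energy_cz_term`).

`projection_step` replaces a state by its projection onto the next subspace. It loses at most 1/4 of
energy and gains twice Δ times the squared displacement; of the remaining terms it uses only a norm
bound. The history state has energy at most 1, because only the output term sees it, with value at
most (T+M)/(T+M+1). By the variational principle a ground state does no worse, so in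
`projection_chain` the four squared displacements sum to at most 1/Δ. The acceptance probability
plays no role.

The norms in the coupling conditions contain `HOut` with coefficient 1 and do not display the factor
(T+M+1)² lost in propagation. Both gaps are closed by a test state with all input bits flipped: it
shows that these norms are at least the input coupling, which in turn dominates T+M
(`le_opNorm_of_HIn`).

During the idling steps the history state does not move, so its fidelity with the guiding state is
(M+1)/(T+M+1), and `fidelity_triangle` combines the two losses. For the polynomial parameters, M and
Δ are chosen so that each loss is at most 1/(4q); the couplings are then fixed from weakest to
strongest by evaluating the coupling polynomial at norm bounds for the terms already chosen. -/

theorem applyOp_add (A B : QOp Q) (v : QState Q) :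
    applyOp (A + B) v = applyOp A v + applyOp B v := by
  simp [applyOp]

theorem applyOp_smul (c : ℂ) (A : QOp Q) (v : QState Q) :
    applyOp (c • A) v = c • applyOp A v := by
  simp [applyOp]

theorem real_smul_op (c : ℝ) (A : QOp Q) : c • A = (c : ℂ) • A := by
  ext; simp

theorem applyOp_sum {ι : Type*} (s : Finset ι) (A : ι → QOp Q) (v : QState Q) :
    applyOp (∑ i ∈ s, A i) v = ∑ i ∈ s, applyOp (A i) v := by
  simp [applyOp]

theorem applyOp_apply (A : QOp Q) (v : QState Q) (x : Q → Bool) :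
    applyOp A v x = ∑ y, A x y * v y := by
  simp [applyOp, Matrix.toLpLin_apply, Matrix.mulVec, dotProduct]

theorem applyOp_mul (A B : QOp Q) (v : QState Q) :
    applyOp (A * B) v = applyOp A (applyOp B v) := by
  simp [applyOp, Matrix.toLpLin_apply]

@[simp] theorem applyOp_one (v : QState Q) : applyOp (1 : QOp Q) v = v := by
  simp [applyOp]

@[simp] theorem applyOp_vec_add (A : QOp Q) (v w : QState Q) :
    applyOp A (v + w) = applyOp A v + applyOp A w := map_add _ _ _

@[simp] theorem applyOp_vec_sub (A : QOp Q) (v w : QState Q) :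
    applyOp A (v - w) = applyOp A v - applyOp A w := map_sub _ _ _

@[simp] theorem applyOp_vec_smul (A : QOp Q) (c : ℂ) (v : QState Q) :
    applyOp A (c • v) = c • applyOp A v := map_smul _ _ _

@[simp] theorem applyOp_vec_zero (A : QOp Q) : applyOp A 0 = 0 := map_zero _

theorem norm_applyOp_le (A : QOp Q) (v : QState Q) : ‖applyOp A v‖ ≤ opNorm A * ‖v‖ :=
  (Matrix.toEuclideanCLM (𝕜 := ℂ) A).le_opNorm v

theorem opNorm_nonneg (A : QOp Q) : 0 ≤ opNorm A := norm_nonneg _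

theorem opNorm_add_le (A B : QOp Q) : opNorm (A + B) ≤ opNorm A + opNorm B := by
  unfold opNorm; rw [map_add]; exact norm_add_le _ _

theorem opNorm_sub_le (A B : QOp Q) : opNorm (A - B) ≤ opNorm A + opNorm B := by
  unfold opNorm; rw [map_sub]; exact norm_sub_le _ _

theorem opNorm_smul (c : ℂ) (A : QOp Q) : opNorm (c • A) = ‖c‖ * opNorm A := by
  unfold opNorm; rw [map_smul, norm_smul]

theorem opNorm_real_smul (c : ℝ) (A : QOp Q) : opNorm (c • A) = |c| * opNorm A := by
  rw [real_smul_op, opNorm_smul]; simp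

theorem opNorm_mul_le (A B : QOp Q) : opNorm (A * B) ≤ opNorm A * opNorm B := by
  unfold opNorm; rw [map_mul]; exact norm_mul_le _ _

theorem opNorm_sum_le {ι : Type*} (s : Finset ι) (A : ι → QOp Q) :
    opNorm (∑ i ∈ s, A i) ≤ ∑ i ∈ s, opNorm (A i) := by
  unfold opNorm; rw [map_sum]; exact norm_sum_le _ _

open scoped Matrix.Norms.L2Operator in
theorem opNorm_eq_norm (A : QOp Q) : opNorm A = ‖A‖ := rfl

theorem opNorm_conjTranspose_mul_self (A : QOp Q) :
    opNorm (A.conjTranspose * A) = opNorm A * opNorm A := by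
  simp only [opNorm_eq_norm]
  exact Matrix.l2_opNorm_conjTranspose_mul_self A

theorem opNorm_conjTranspose (A : QOp Q) : opNorm A.conjTranspose = opNorm A := by
  simp only [opNorm_eq_norm]
  exact Matrix.l2_opNorm_conjTranspose A

theorem opNorm_one_le : opNorm (1 : QOp Q) ≤ 1 := by
  unfold opNorm
  rw [map_one]
  exact ContinuousLinearMap.norm_id_le

/-- The sesquilinear form `⟨v|A|w⟩`. -/
def sesq (A : QOp Q) (v w : QState Q) : ℂ := inner ℂ v (applyOp A w)

/-- The expectation value `Re ⟨v|A|v⟩`. -/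
def energy (A : QOp Q) (v : QState Q) : ℝ := (sesq A v v).re

theorem sesq_add (A B : QOp Q) (v w : QState Q) : sesq (A + B) v w = sesq A v w + sesq B v w := by
  simp [sesq, applyOp_add]

theorem sesq_smul (c : ℂ) (A : QOp Q) (v w : QState Q) : sesq (c • A) v w = c * sesq A v w := by
  simp [sesq, applyOp_smul]

theorem sesq_sub (A B : QOp Q) (v w : QState Q) : sesq (A - B) v w = sesq A v w - sesq B v w := by
  rw [sub_eq_add_neg, ← neg_one_smul ℂ B, sesq_add, sesq_smul]; ring

theorem sesq_sum {ι : Type*} (s : Finset ι) (A : ι → QOp Q) (v w : QState Q) :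
    sesq (∑ i ∈ s, A i) v w = ∑ i ∈ s, sesq (A i) v w := by
  simp [sesq, applyOp_sum]

theorem energy_add (A B : QOp Q) (v : QState Q) :
    energy (A + B) v = energy A v + energy B v := by
  simp [energy, sesq_add]

theorem energy_smul (c : ℝ) (A : QOp Q) (v : QState Q) :
    energy (c • A) v = c * energy A v := by
  rw [energy, real_smul_op, sesq_smul, Complex.re_ofReal_mul, energy]

theorem energy_sum {ι : Type*} (s : Finset ι) (A : ι → QOp Q) (v : QState Q) :
    energy (∑ i ∈ s, A i) v = ∑ i ∈ s, energy (A i) v := by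
  simp [energy, sesq_sum]

theorem abs_sesq_re_le (A : QOp Q) (v w : QState Q) :
    |(sesq A v w).re| ≤ opNorm A * ‖v‖ * ‖w‖ := by
  calc |(sesq A v w).re| ≤ ‖sesq A v w‖ := Complex.abs_re_le_norm _
    _ ≤ ‖v‖ * ‖applyOp A w‖ := norm_inner_le_norm _ _
    _ ≤ ‖v‖ * (opNorm A * ‖w‖) := by gcongr; exact norm_applyOp_le _ _
    _ = _ := by ring

theorem energy_le_opNorm (A : QOp Q) (v : QState Q) (hv : ‖v‖ = 1) : energy A v ≤ opNorm A := by
  have := abs_sesq_re_le A v v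
  rw [hv] at this
  simpa [energy] using (le_abs_self _).trans this

/-- One step of the projection lemma: a strong penalty `J • B` forces a state of low energy to be
close to the subspace `S`. -/
theorem projection_step (S : Submodule ℂ (QState Q)) (A B : QOp Q) (v : QState Q)
    (hv : ‖v‖ ≤ 1) {a c J D : ℝ} (hA : opNorm A ≤ a) (hD : 0 ≤ D) (hc : 0 < c)
    (hJ : c * (9 * a ^ 2 + 2 * D) ≤ J)
    (hB : ∃ u ∈ S, ‖v - u‖ ^ 2 ≤ c * energy B v) :
    ∃ w ∈ S, ‖w‖ ≤ 1 ∧ ‖v‖ ^ 2 = ‖w‖ ^ 2 + ‖v - w‖ ^ 2 ∧ (∀ u ∈ S, inner ℂ u (v - w) = 0) ∧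
      energy A w + 2 * D * ‖v - w‖ ^ 2 - 1 / 4 ≤ energy (A + J • B) v := by
  obtain ⟨u, hu, huB⟩ := hB
  -- The given `u` need not be the nearest point of `S`; the orthogonal projection is at least as
  -- close and moreover yields Pythagoras.
  set w := S.starProjection v with hw
  have hwS : w ∈ S := S.starProjection_apply_mem v
  have horth : ∀ u ∈ S, inner ℂ u (v - w) = 0 := fun u hu =>
    S.inner_right_of_mem_orthogonal hu (S.sub_starProjection_mem_orthogonal v)
  have hpyth : ∀ u ∈ S, ‖v - u‖ ^ 2 = ‖w - u‖ ^ 2 + ‖v - w‖ ^ 2 := by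
    intro u hu
    have h := norm_add_sq_eq_norm_sq_add_norm_sq_of_inner_eq_zero (𝕜 := ℂ) (w - u) (v - w)
      (horth _ (S.sub_mem hwS hu))
    have e : w - u + (v - w) = v - u := by abel
    rw [e] at h
    nlinarith
  have h0 := hpyth 0 S.zero_mem
  simp only [sub_zero] at h0
  have hw1 : ‖w‖ ≤ 1 := by nlinarith [norm_nonneg w, norm_nonneg v, sq_nonneg ‖v - w‖]
  have hd1 : ‖v - w‖ ≤ 1 := by nlinarith [norm_nonneg v, norm_nonneg (v - w), sq_nonneg ‖w‖]
  refine ⟨w, hwS, hw1, h0, horth, ?_⟩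
  set d := v - w with hd
  have hvd : v = w + d := by rw [hd]; abel
  have ha : 0 ≤ a := (opNorm_nonneg A).trans hA
  have hAv : energy A v = energy A w + (sesq A w d).re + (sesq A d w).re + (sesq A d d).re := by
    conv_lhs => rw [hvd]
    simp only [energy, sesq, applyOp_vec_add, inner_add_left, inner_add_right, Complex.add_re]
    ring
  -- Each of the three terms of `hAv` containing `d` costs at most `a * ‖d‖`; the quadratic one
  -- because `‖d‖ ≤ 1`.
  have hb : ∀ x y : QState Q, ‖x‖ ≤ 1 → -(a * ‖y‖) ≤ (sesq A x y).re ∧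
      -(a * ‖y‖) ≤ (sesq A y x).re := by
    intro x y hx
    have h1 := (abs_le.1 (abs_sesq_re_le A x y)).1
    have h2 := (abs_le.1 (abs_sesq_re_le A y x)).1
    have h3 : opNorm A * ‖x‖ * ‖y‖ ≤ a * ‖y‖ := by
      gcongr
      nlinarith [opNorm_nonneg A, norm_nonneg x]
    constructor <;> nlinarith
  have h1 := (hb w d hw1).1
  have h2 := (hb w d hw1).2
  have h3 := (hb d d hd1).1
  have hJ0 : 0 ≤ J := le_trans (by positivity) hJ
  have hBv : (9 * a ^ 2 + 2 * D) * ‖d‖ ^ 2 ≤ J * energy B v := by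
    have hdu : ‖d‖ ^ 2 ≤ c * energy B v := by
      have := hpyth u hu
      nlinarith [sq_nonneg ‖w - u‖]
    have hBn : 0 ≤ energy B v := by
      by_contra hneg
      push Not at hneg
      nlinarith [sq_nonneg ‖d‖]
    calc (9 * a ^ 2 + 2 * D) * ‖d‖ ^ 2 ≤ (9 * a ^ 2 + 2 * D) * (c * energy B v) := by gcongr
      _ = c * (9 * a ^ 2 + 2 * D) * energy B v := by ring
      _ ≤ _ := by gcongr
  rw [energy_add, energy_smul, hAv]
  -- The total loss `3 * a * ‖d‖` is absorbed by completing the square; this is where `9 * a ^ 2`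
  -- and the constant 1/4 come from.
  nlinarith [sq_nonneg (3 * a * ‖d‖ - 1 / 2)]

end Energy

/-! ### Operators on single qubits -/

section SingleQubit

variable {Q : Type} [Fintype Q] [DecidableEq Q]

theorem onQubit_apply (q : Q) (A : Matrix Bool Bool ℂ) (a b : Q → Bool) :
    onQubit q A a b = if ∀ r, r ≠ q → a r = b r then A (a q) (b q) else 0 := rfl

theorem agree_off_iff (q : Q) (a b : Q → Bool) :
    (∀ r, r ≠ q → a r = b r) ↔ b = Function.update a q (b q) := by
  constructor
  · intro h
    ext r
    by_cases hr : r = q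
    · subst hr; simp
    · simp [Function.update_of_ne hr, h r hr]
  · intro h r hr
    rw [h, Function.update_of_ne hr]

/-- A row of a one-qubit operator is supported on the two strings that differ from `a` at most at
`q`. -/
theorem sum_onQubit_mul (q : Q) (A : Matrix Bool Bool ℂ) (a : Q → Bool) (f : (Q → Bool) → ℂ) :
    ∑ b, onQubit q A a b * f b = ∑ β, A (a q) β * f (Function.update a q β) := by
  symm
  apply Finset.sum_of_injOn (fun β => Function.update a q β)
  · intro β _ γ _ h
    exact Function.update_injective a q h
  · simp
  · intro b _ hb
    rw [onQubit_apply, if_neg, zero_mul]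
    intro h
    exact hb ⟨b q, by simp, ((agree_off_iff q a b).1 h).symm⟩
  · intro β _
    rw [onQubit_apply, if_pos]
    · simp
    · intro r hr; rw [Function.update_of_ne hr]

theorem onQubit_mul_onQubit (q : Q) (A B : Matrix Bool Bool ℂ) :
    onQubit q A * onQubit q B = onQubit q (A * B) := by
  ext a b
  rw [Matrix.mul_apply, sum_onQubit_mul]
  simp only [onQubit_apply, Function.update_self]
  have h : ∀ β, (∀ r, r ≠ q → Function.update a q β r = b r) ↔ ∀ r, r ≠ q → a r = b r := by
    intro β
    refine forall₂_congr fun r hr => ?_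
    rw [Function.update_of_ne hr]
  simp only [h]
  split_ifs
  · rw [Matrix.mul_apply]
  · simp

theorem onQubit_mul_apply {q r : Q} (hqr : q ≠ r) (A B : Matrix Bool Bool ℂ) (a b : Q → Bool) :
    (onQubit q A * onQubit r B) a b =
      if ∀ s, s ≠ q → s ≠ r → a s = b s then A (a q) (b q) * B (a r) (b r) else 0 := by
  rw [Matrix.mul_apply, sum_onQubit_mul, Finset.sum_eq_single (b q)]
  · simp only [onQubit_apply, Function.update_of_ne hqr.symm]
    have : (∀ s, s ≠ r → Function.update a q (b q) s = b s) ↔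
        ∀ s, s ≠ q → s ≠ r → a s = b s := by
      refine forall_congr' fun s => ?_
      by_cases hs : s = q
      · subst hs; simp
      · simp [hs]
    simp only [this]
    split_ifs <;> simp
  · intro β _ hβ
    rw [onQubit_apply, if_neg, mul_zero]
    intro h
    exact hβ (by simpa using h q hqr)
  · simp

theorem onQubit_commute {q r : Q} (hqr : q ≠ r) (A B : Matrix Bool Bool ℂ) :
    onQubit q A * onQubit r B = onQubit r B * onQubit q A := by
  ext a b
  rw [onQubit_mul_apply hqr, onQubit_mul_apply hqr.symm, mul_comm]
  congr 1
  exact propext (forall_congr' fun s => ⟨fun h h1 h2 => h h2 h1, fun h h1 h2 => h h2 h1⟩)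

theorem onQubit_conjTranspose (q : Q) (A : Matrix Bool Bool ℂ) :
    (onQubit q A).conjTranspose = onQubit q A.conjTranspose := by
  ext a b
  have : (∀ r, r ≠ q → b r = a r) ↔ (∀ r, r ≠ q → a r = b r) :=
    forall₂_congr fun r _ => eq_comm
  simp only [Matrix.conjTranspose_apply, onQubit_apply, this]
  split_ifs <;> simp

theorem onQubit_one (q : Q) : onQubit q 1 = (1 : QOp Q) := by
  ext a b
  rw [onQubit_apply, Matrix.one_apply, Matrix.one_apply]
  by_cases h : a = b
  · subst h; simp
  · rw [if_neg h]
    split_ifs with h1 h2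
    · exact absurd (funext fun r => by
        by_cases hr : r = q
        · rw [hr, h2]
        · exact h1 r hr) h
    · rfl
    · rfl

theorem ketbra_apply (q : Q) (α β : Bool) (a b : Q → Bool) :
    ketbra q α β a b = if (∀ r, r ≠ q → a r = b r) ∧ a q = α ∧ b q = β then 1 else 0 := by
  rw [ketbra, onQubit_apply, Matrix.single_apply]
  simp only [ite_and, @eq_comm _ α, @eq_comm _ β]

theorem ketbra_conjTranspose (q : Q) (α β : Bool) :
    (ketbra q α β).conjTranspose = ketbra q β α := by
  rw [ketbra, onQubit_conjTranspose, Matrix.conjTranspose_single, star_one, ketbra]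

/-- By the C*-identity the squared norm equals the norm of the projector `ketbra q β β`, and the
norm of that projector equals its own square. -/
theorem opNorm_ketbra_le (q : Q) (α β : Bool) : opNorm (ketbra q α β) ≤ 1 := by
  have hmul : ∀ α β : Bool, (ketbra q α β).conjTranspose * ketbra q α β = ketbra q β β := by
    intro α β
    rw [ketbra_conjTranspose, ketbra, ketbra, onQubit_mul_onQubit, Matrix.single_mul_single_same,
      mul_one, ketbra]
  have h1 := opNorm_conjTranspose_mul_self (ketbra q α β)
  have h2 := opNorm_conjTranspose_mul_self (ketbra q β β)
  rw [hmul] at h1 h2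
  have h3 := opNorm_nonneg (ketbra q β β)
  have h4 := opNorm_nonneg (ketbra q α β)
  have h5 : opNorm (ketbra q β β) ≤ 1 := by
    by_contra! h
    nlinarith
  nlinarith

theorem onQubit_unitary (q : Q) (u : Matrix.unitaryGroup Bool ℂ) :
    (onQubit q (u : Matrix Bool Bool ℂ)).conjTranspose * onQubit q u = 1 := by
  rw [onQubit_conjTranspose, onQubit_mul_onQubit, ← Matrix.star_eq_conjTranspose,
    Unitary.coe_star_mul_self, onQubit_one]

theorem czOp_unitary (f s : Q) : (czOp f s).conjTranspose * czOp f s = 1 := by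
  rw [czOp, Matrix.diagonal_conjTranspose, Matrix.diagonal_mul_diagonal, ← Matrix.diagonal_one]
  congr 1
  ext a
  simp only [Pi.star_apply]
  split_ifs <;> simp

theorem opNorm_le_one_of_isometry (A : QOp Q) (hA : A.conjTranspose * A = 1) : opNorm A ≤ 1 := by
  have h := opNorm_conjTranspose_mul_self A
  rw [hA] at h
  nlinarith [opNorm_one_le (Q := Q), opNorm_nonneg A]

theorem inner_applyOp_left (A : QOp Q) (v w : QState Q) :
    inner ℂ (applyOp A v) w = inner ℂ v (applyOp A.conjTranspose w) := by
  simp only [applyOp, Matrix.toEuclideanLin_conjTranspose_eq_adjoint,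
    LinearMap.adjoint_inner_right]

theorem inner_applyOp_isometry (A : QOp Q) (hA : A.conjTranspose * A = 1) (v w : QState Q) :
    inner ℂ (applyOp A v) (applyOp A w) = inner ℂ v w := by
  rw [inner_applyOp_left, ← applyOp_mul, hA, applyOp_one]

theorem norm_applyOp_isometry (A : QOp Q) (hA : A.conjTranspose * A = 1) (v : QState Q) :
    ‖applyOp A v‖ = ‖v‖ := by
  rw [@norm_eq_sqrt_re_inner ℂ, @norm_eq_sqrt_re_inner ℂ _ _ _ _ v, inner_applyOp_isometry A hA]

/-! ### Locality -/

theorem ActsOn.onQubit_mul {q r : Q} (hqr : q ≠ r) (A B : Matrix Bool Bool ℂ) :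
    ActsOn {q, r} (onQubit q A * onQubit r B) := by
  refine ⟨Matrix.of fun a b => A (a ⟨q, by simp⟩) (b ⟨q, by simp⟩) *
    B (a ⟨r, by simp⟩) (b ⟨r, by simp⟩), fun a b => ?_⟩
  rw [onQubit_mul_apply hqr]
  simp

theorem ActsOn.onQubit (q : Q) (A : Matrix Bool Bool ℂ) : ActsOn {q} (onQubit q A) := by
  refine ⟨Matrix.of fun a b => A (a ⟨q, by simp⟩) (b ⟨q, by simp⟩), fun a b => ?_⟩
  rw [onQubit_apply]
  simp

theorem ActsOn.add {S : Finset Q} {A B : QOp Q} (hA : ActsOn S A) (hB : ActsOn S B) :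
    ActsOn S (A + B) := by
  obtain ⟨A', hA⟩ := hA
  obtain ⟨B', hB⟩ := hB
  refine ⟨A' + B', fun a b => ?_⟩
  rw [Matrix.add_apply, hA, hB]
  split_ifs <;> simp

theorem ActsOn.smul {S : Finset Q} {A : QOp Q} (c : ℂ) (hA : ActsOn S A) : ActsOn S (c • A) := by
  obtain ⟨A', hA⟩ := hA
  refine ⟨c • A', fun a b => ?_⟩
  rw [Matrix.smul_apply, hA]
  split_ifs <;> simp

theorem IsLocalHamiltonian.zero (k : ℕ) : IsLocalHamiltonian k (0 : QOp Q) :=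
  ⟨0, fun i => i.elim0, fun i => i.elim0, by simp⟩

theorem IsLocalHamiltonian.of_actsOn {k : ℕ} {H : QOp Q} {S : Finset Q} (hH : H.IsHermitian)
    (hS : S.card ≤ k) (h : ActsOn S H) : IsLocalHamiltonian k H :=
  ⟨1, fun _ => H, fun _ => ⟨hH, S, hS, h⟩, by simp⟩

theorem IsLocalHamiltonian.add {k : ℕ} {A B : QOp Q} (hA : IsLocalHamiltonian k A)
    (hB : IsLocalHamiltonian k B) : IsLocalHamiltonian k (A + B) := by
  obtain ⟨m, h, h1, rfl⟩ := hA
  obtain ⟨m', h', h1', rfl⟩ := hB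
  refine ⟨m + m', Fin.append h h', fun i => ?_, by simp [Fin.sum_univ_add]⟩
  refine Fin.addCases (fun i => ?_) (fun i => ?_) i
  · simpa using h1 i
  · simpa using h1' i

theorem IsLocalHamiltonian.smul {k : ℕ} {A : QOp Q} (c : ℝ) (hA : IsLocalHamiltonian k A) :
    IsLocalHamiltonian k (c • A) := by
  obtain ⟨m, h, h1, rfl⟩ := hA
  refine ⟨m, fun i => c • h i, fun i => ⟨?_, ?_⟩, Finset.smul_sum⟩
  · rw [Matrix.IsHermitian, Matrix.conjTranspose_smul, (h1 i).1.eq, star_trivial]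
  · obtain ⟨S, hS, hA⟩ := (h1 i).2
    exact ⟨S, hS, by
      have := hA.smul (c : ℂ)
      rwa [← real_smul_op] at this⟩

theorem IsLocalHamiltonian.sum {k : ℕ} {ι : Type*} (s : Finset ι) (A : ι → QOp Q)
    (hA : ∀ i ∈ s, IsLocalHamiltonian k (A i)) : IsLocalHamiltonian k (∑ i ∈ s, A i) := by
  classical
  induction s using Finset.induction_on with
  | empty => simpa using IsLocalHamiltonian.zero k
  | insert i s hi ih =>
    rw [Finset.sum_insert hi]
    exact (hA i (by simp)).add (ih fun j hj => hA j (by simp [hj]))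

end SingleQubit

section Locality

variable {Q : Type} [Fintype Q] [DecidableEq Q]

theorem onQubit_add (q : Q) (A B : Matrix Bool Bool ℂ) :
    onQubit q (A + B) = onQubit q A + onQubit q B := by
  ext a b
  simp only [onQubit_apply, Matrix.add_apply]
  split_ifs <;> simp

theorem onQubit_mul_conjTranspose {q r : Q} (hqr : q ≠ r) (A B : Matrix Bool Bool ℂ) :
    (onQubit q A * onQubit r B).conjTranspose =
      onQubit q A.conjTranspose * onQubit r B.conjTranspose := by
  rw [Matrix.conjTranspose_mul, onQubit_conjTranspose, onQubit_conjTranspose,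
    onQubit_commute hqr.symm]

theorem isLocalHamiltonian_onQubit (q : Q) {A : Matrix Bool Bool ℂ} (hA : A.IsHermitian) :
    IsLocalHamiltonian 2 (onQubit q A) :=
  .of_actsOn (by rw [Matrix.IsHermitian, onQubit_conjTranspose, hA.eq]) (by simp)
    (ActsOn.onQubit q A)

theorem isLocalHamiltonian_onQubit_mul {q r : Q} (hqr : q ≠ r) {A B : Matrix Bool Bool ℂ}
    (hA : A.IsHermitian) (hB : B.IsHermitian) :
    IsLocalHamiltonian 2 (onQubit q A * onQubit r B) :=
  .of_actsOn (by rw [Matrix.IsHermitian, onQubit_mul_conjTranspose hqr, hA.eq, hB.eq])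
    Finset.card_le_two (ActsOn.onQubit_mul hqr A B)

/-- An off-diagonal product is not Hermitian by itself, so it enters together with its adjoint as a
single local term. -/
theorem isLocalHamiltonian_onQubit_mul_add {q r : Q} (hqr : q ≠ r) {A A' B B' : Matrix Bool Bool ℂ}
    (hA : A.conjTranspose = A') (hB : B.conjTranspose = B') :
    IsLocalHamiltonian 2 (onQubit q A * onQubit r B + onQubit q A' * onQubit r B') := by
  refine .of_actsOn ?_ Finset.card_le_two
    ((ActsOn.onQubit_mul hqr A B).add (ActsOn.onQubit_mul hqr A' B'))
  subst hA hB
  rw [Matrix.IsHermitian, Matrix.conjTranspose_add, onQubit_mul_conjTranspose hqr,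
    onQubit_mul_conjTranspose hqr, Matrix.conjTranspose_conjTranspose,
    Matrix.conjTranspose_conjTranspose, add_comm]

theorem isHermitian_single (a : Bool) : (Matrix.single a a (1 : ℂ)).IsHermitian := by
  rw [Matrix.IsHermitian, Matrix.conjTranspose_single, star_one]

theorem conjTranspose_single_one (a b : Bool) :
    (Matrix.single a b (1 : ℂ)).conjTranspose = Matrix.single b a 1 := by
  rw [Matrix.conjTranspose_single, star_one]

theorem isLocalHamiltonian_ketbra (q : Q) (a : Bool) : IsLocalHamiltonian 2 (ketbra q a a) :=
  isLocalHamiltonian_onQubit q (isHermitian_single a)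

end Locality

/-! ### Locality of the clock operators. -/

theorem clockKB_cases (N K t : ℕ) :
    (∀ a b, clockKB N K t a b = 0) ∨
      ∃ j : Fin K, (j : ℕ) + 1 = t ∧ ∀ a b, clockKB N K t a b = ketbra (Sum.inr j) a b := by
  by_cases h : 1 ≤ t ∧ t ≤ K
  · exact .inr ⟨⟨t - 1, by omega⟩, by simp; omega, fun a b => by rw [clockKB, dif_pos h]⟩
  · exact .inl fun a b => by rw [clockKB, dif_neg h]

theorem opNorm_zero {Q : Type} [Fintype Q] [DecidableEq Q] : opNorm (0 : QOp Q) = 0 := by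
  simp [opNorm]

theorem opNorm_clockKB_le (N K t : ℕ) (a b : Bool) : opNorm (clockKB N K t a b) ≤ 1 := by
  rcases clockKB_cases N K t with h | ⟨j, -, h⟩
  · rw [h, opNorm_zero]; exact zero_le_one
  · rw [h]; exact opNorm_ketbra_le _ _ _

theorem isLocalHamiltonian_clockKB (N K t : ℕ) (a : Bool) :
    IsLocalHamiltonian 2 (clockKB N K t a a) := by
  rcases clockKB_cases N K t with h | ⟨j, -, h⟩
  · rw [h]; exact .zero 2
  · rw [h]; exact isLocalHamiltonian_ketbra _ _

theorem isLocalHamiltonian_clockKB_mul (N K : ℕ) {s t : ℕ} (hst : s ≠ t) (a b : Bool) :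
    IsLocalHamiltonian 2 (clockKB N K s a a * clockKB N K t b b) := by
  rcases clockKB_cases N K s with h | ⟨j, hj, h⟩
  · rw [h, zero_mul]; exact .zero 2
  rcases clockKB_cases N K t with h' | ⟨j', hj', h'⟩
  · rw [h', mul_zero]; exact .zero 2
  rw [h, h']
  exact isLocalHamiltonian_onQubit_mul (by rintro ⟨⟩; omega) (isHermitian_single _)
    (isHermitian_single _)

theorem isLocalHamiltonian_clockX (N K t : ℕ) : IsLocalHamiltonian 2 (clockX N K t) := by
  rcases clockKB_cases N K t with h | ⟨j, -, h⟩
  · rw [clockX, h, h, add_zero]; exact .zero 2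
  rw [clockX, h, h, ketbra, ketbra, ← onQubit_add]
  refine isLocalHamiltonian_onQubit _ ?_
  rw [Matrix.IsHermitian, Matrix.conjTranspose_add, conjTranspose_single_one,
    conjTranspose_single_one, add_comm]

theorem isLocalHamiltonian_onQubit_mul_clockKB {N K : ℕ} (q : Fin N) (A : Matrix Bool Bool ℂ)
    (t : ℕ) : IsLocalHamiltonian 2 (onQubit (.inl q) A * clockKB N K t true false +
      (onQubit (.inl q) A).conjTranspose * clockKB N K t false true) := by
  rcases clockKB_cases N K t with h | ⟨j, -, h⟩
  · rw [h, h, mul_zero, mul_zero, add_zero]; exact .zero 2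
  rw [h, h, onQubit_conjTranspose]
  exact isLocalHamiltonian_onQubit_mul_add (by simp) rfl (conjTranspose_single_one _ _)

theorem isLocalHamiltonian_ketbra_mul_clockX {N K : ℕ} (q : Fin N) (a : Bool) (t : ℕ) :
    IsLocalHamiltonian 2 (ketbra (.inl q) a a * clockX N K t) := by
  have h := isLocalHamiltonian_onQubit_mul_clockKB (K := K) q (Matrix.single a a 1) t
  rwa [onQubit_conjTranspose, conjTranspose_single_one, ← mul_add] at h

theorem isLocalHamiltonian_ketbra_mul_clockKB {N K : ℕ} (q : Fin N) (a : Bool) (t : ℕ) (b : Bool) :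
    IsLocalHamiltonian 2 (ketbra (.inl q) a a * clockKB N K t b b) := by
  rcases clockKB_cases N K t with h | ⟨j, -, h⟩
  · rw [h, mul_zero]; exact .zero 2
  rw [h]
  exact isLocalHamiltonian_onQubit_mul (by simp) (isHermitian_single _) (isHermitian_single _)

theorem isLocalHamiltonian_clock10 (N K t : ℕ) : IsLocalHamiltonian 2 (clock10 N K t) :=
  isLocalHamiltonian_clockKB_mul N K (by omega) _ _

theorem isLocalHamiltonian_clockXX (N K t : ℕ) : IsLocalHamiltonian 2 (clockXX N K t) := by
  rcases clockKB_cases N K t with h | ⟨j, hj, h⟩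
  · simp only [clockXX, h, zero_mul, add_zero]; exact .zero 2
  rcases clockKB_cases N K (t + 1) with h' | ⟨j', hj', h'⟩
  · simp only [clockXX, h', mul_zero, add_zero]; exact .zero 2
  simp only [clockXX, h, h']
  exact isLocalHamiltonian_onQubit_mul_add (by rintro ⟨⟩; omega) (conjTranspose_single_one _ _)
    (conjTranspose_single_one _ _)

/-! ### Locality of the whole Hamiltonian. -/

namespace RegularCircuit

variable {N : ℕ} (C : RegularCircuit N) (M : ℕ)

theorem mem_czTimes {t : ℕ} : t ∈ C.czTimes M ↔ ∃ l, 1 ≤ l ∧ l ≤ C.T₂ ∧ l * C.L + M = t := by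
  simp [czTimes, and_assoc]

/-- The gate of the idled circuit at time `t` as an operator on the register. -/
theorem idled_eq_onQubit (hN : 0 < N) (K : ℕ) {t : ℕ} (ht : t ∈ Finset.Icc 1 (C.T + M) \ C.czTimes M) :
    ∃ (q : Fin N) (u : Matrix.unitaryGroup Bool ℂ),
      C.idled M K t = onQubit (.inl q) (u : Matrix Bool Bool ℂ) := by
  rw [Finset.mem_sdiff, Finset.mem_Icc, mem_czTimes] at ht
  -- An idling step counts as the identity gate on qubit 0; this needs a nonempty register.
  by_cases h : t ≤ M
  · exact ⟨⟨0, hN⟩, 1, by rw [idled, if_pos h]; exact (onQubit_one _).symm⟩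
  · obtain ⟨q, u, hg⟩ := C.gate_one (t - M) (by omega) (by have := ht.1.2; rw [T] at this; omega)
      (fun l h1 h2 h3 => ht.2 ⟨l, h1, h2, by omega⟩)
    exact ⟨q, u, by rw [idled, if_neg h, hg]; rfl⟩

theorem isLocalHamiltonian_HPropAt (hN : 0 < N) {t : ℕ}
    (ht : t ∈ Finset.Icc 1 (C.T + M) \ C.czTimes M) :
    IsLocalHamiltonian 2 (C.HPropAt M t) := by
  obtain ⟨q, u, hu⟩ := C.idled_eq_onQubit M hN (C.T + M) ht
  rw [HPropAt]
  simp only [hu]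
  -- The two transition terms are grouped into one Hermitian summand with a real coefficient.
  rw [sub_sub, sub_eq_add_neg, ← neg_one_smul ℝ, show (1 / 2 : ℂ) = ((1 / 2 : ℝ) : ℂ) by simp,
    ← real_smul_op]
  refine .smul _ (.add (.add ?_ ?_) (.smul _ (isLocalHamiltonian_onQubit_mul_clockKB q _ t)))
  · split_ifs
    · exact isLocalHamiltonian_clockKB _ _ _ _
    · exact isLocalHamiltonian_clock10 _ _ _
  · split_ifs
    · exact isLocalHamiltonian_clockKB _ _ _ _
    · exact isLocalHamiltonian_clock10 _ _ _

theorem isLocalHamiltonian_HQubitAt (t : ℕ) : IsLocalHamiltonian 2 (C.HQubitAt M t) := by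
  rw [HQubitAt]
  split
  · exact .zero 2
  · rw [show (1 / 2 : ℂ) = ((1 / 2 : ℝ) : ℂ) by simp, show (-2 : ℂ) = ((-2 : ℝ) : ℂ) by simp]
    simp only [← real_smul_op, smul_mul_assoc, add_mul]
    exact .smul _ (.add (.add (.add (.smul _ (isLocalHamiltonian_ketbra_mul_clockX _ _ _))
      (.smul _ (isLocalHamiltonian_ketbra_mul_clockX _ _ _)))
      (isLocalHamiltonian_ketbra_mul_clockX _ _ _)) (isLocalHamiltonian_ketbra_mul_clockX _ _ _))

theorem isLocalHamiltonian_HTimeAt (t : ℕ) : IsLocalHamiltonian 2 (C.HTimeAt M t) := by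
  rw [HTimeAt, show (1 / 8 : ℂ) = ((1 / 8 : ℝ) : ℂ) by simp, show (6 : ℂ) = ((6 : ℝ) : ℂ) by simp,
    show (2 : ℂ) = ((2 : ℝ) : ℂ) by simp]
  simp only [← real_smul_op]
  have hP := fun j => isLocalHamiltonian_clock10 N (C.T + M) j
  have hX := fun j => isLocalHamiltonian_clockX N (C.T + M) j
  have hY := fun j => (isLocalHamiltonian_clockXX N (C.T + M) j).smul 2
  have h6 := fun j => (hP j).smul 6
  exact .smul _ ((((((((((((hP _).add (h6 _)).add (hP _)).add (hY _)).add (hX _)).add (hX _)).add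
    (hP _)).add (h6 _)).add (hP _)).add (hY _)).add (hX _)).add (hX _))

theorem isLocalHamiltonian_hamiltonian (hN : 0 < N) (z : Fin N → Bool) (out : Fin N)
    (J : Couplings) : IsLocalHamiltonian 2 (C.hamiltonian M z out J) := by
  refine .add (.add (.add (.add (.smul _ ?_) (.smul _ ?_)) (.smul _ ?_)) (.smul _ ?_)) (.smul _ ?_)
  · exact .sum _ _ fun i _ => isLocalHamiltonian_ketbra_mul_clockKB _ _ _ _
  · exact .sum _ _ fun i _ => isLocalHamiltonian_clockKB_mul _ _ (by omega) _ _
  · exact .sum _ _ fun t ht => C.isLocalHamiltonian_HPropAt M hN ht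
  · exact .sum _ _ fun t _ => .add (C.isLocalHamiltonian_HQubitAt M t)
      (C.isLocalHamiltonian_HTimeAt M t)
  · exact isLocalHamiltonian_ketbra_mul_clockKB _ _ _ _

end RegularCircuit

/-! ### Unary clock states -/

/-- The unary clock state `1⋯10⋯0` with `t` ones. -/
def unary (K t : ℕ) : Fin K → Bool := fun j => decide ((j : ℕ) < t)

theorem unary_injOn (K : ℕ) {s t : ℕ} (hs : s ≤ K) (ht : t ≤ K) (h : unary K s = unary K t) :
    s = t := by
  have key : ∀ s t : ℕ, s ≤ K → t ≤ K → unary K s = unary K t → ¬ s < t := by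
    intro s t hs ht h hst
    have := congrFun h ⟨s, by omega⟩
    simp [unary, hst] at this
  exact le_antisymm (not_lt.1 (key _ _ ht hs h.symm)) (not_lt.1 (key _ _ hs ht h))

/-- Flipping one bit of a unary string gives a unary string only at the boundary between ones and
zeros. So on legal clocks a one-qubit flip already is a transition between two consecutive times,
which keeps the propagation terms local. -/
theorem ketbra_unary_up {K s t : ℕ} (hs : s ≤ K) (ht : t ≤ K) (j : Fin K) :
    ketbra j true false (unary K s) (unary K t) =
      if s = (j : ℕ) + 1 ∧ t = (j : ℕ) then 1 else 0 := by
  rw [ketbra_apply]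
  congr 1
  simp only [unary, decide_eq_decide, decide_eq_true_eq, decide_eq_false_iff_not, eq_iff_iff]
  constructor
  · rintro ⟨h, h1, h2⟩
    have ht' : ¬ t < (j : ℕ) := fun hlt => by
      have := h ⟨t, by omega⟩ (by rw [Ne, Fin.ext_iff]; simp; omega)
      simp at this; omega
    have hs' : ¬ (j : ℕ) + 1 < s := fun hlt => by
      have := h ⟨s - 1, by omega⟩ (by rw [Ne, Fin.ext_iff]; simp; omega)
      simp at this; omega
    omega
  · rintro ⟨rfl, rfl⟩
    refine ⟨fun r hr => ?_, by omega, by omega⟩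
    rw [Ne, Fin.ext_iff] at hr
    omega

theorem ketbra_unary_down {K s t : ℕ} (hs : s ≤ K) (ht : t ≤ K) (j : Fin K) :
    ketbra j false true (unary K s) (unary K t) =
      if s = (j : ℕ) ∧ t = (j : ℕ) + 1 then 1 else 0 := by
  have h := congrFun (congrFun (ketbra_conjTranspose j true false) (unary K s)) (unary K t)
  rw [← h, Matrix.conjTranspose_apply, ketbra_unary_up ht hs]
  simp only [and_comm (a := t = _)]
  split_ifs <;> simp

theorem ketbra_unary_diag {K s t : ℕ} (hs : s ≤ K) (ht : t ≤ K) (j : Fin K) (a : Bool) :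
    ketbra j a a (unary K s) (unary K t) =
      if s = t ∧ decide ((j : ℕ) < s) = a then 1 else 0 := by
  rw [ketbra_apply]
  congr 1
  rw [eq_iff_iff]
  constructor
  · rintro ⟨h, h1, h2⟩
    refine ⟨unary_injOn K hs ht (funext fun r => ?_), h1⟩
    by_cases hr : r = j
    · rw [hr, h1, h2]
    · exact h r hr
  · rintro ⟨rfl, h⟩
    exact ⟨fun r _ => rfl, h, h⟩

theorem ketbra_mul_diag_apply {Q : Type} [Fintype Q] [DecidableEq Q] {q r : Q} (hqr : q ≠ r)
    (α β : Bool) (a b : Q → Bool) :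
    (ketbra q α α * ketbra r β β) a b = if a = b ∧ a q = α ∧ a r = β then 1 else 0 := by
  rw [ketbra, ketbra, onQubit_mul_apply hqr]
  by_cases hab : a = b
  · subst hab
    simp only [implies_true, if_true, Matrix.single_apply, true_and, and_self]
    simp only [eq_comm (a := α), eq_comm (a := β), ite_and]
    split_ifs <;> simp
  · rw [if_neg (c := a = b ∧ _) (by tauto)]
    split_ifs with h
    · by_contra hne
      refine hab (funext fun s => ?_)
      rw [mul_eq_zero, not_or, Matrix.single_apply, Matrix.single_apply] at hne
      have h1 := (ite_ne_right_iff.1 hne.1).1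
      have h2 := (ite_ne_right_iff.1 hne.2).1
      by_cases hq : s = q
      · rw [hq, ← h1.1, ← h1.2]
      · by_cases hr : s = r
        · rw [hr, ← h2.1, ← h2.2]
        · exact h s hq hr
    · rfl

theorem ketbra_mul_diag_unary {K s t : ℕ} (hs : s ≤ K) (ht : t ≤ K) {j j' : Fin K} (hj : j ≠ j')
    (a b : Bool) :
    (ketbra j a a * ketbra j' b b) (unary K s) (unary K t) =
      if s = t ∧ decide ((j : ℕ) < s) = a ∧ decide ((j' : ℕ) < s) = b then 1 else 0 := by
  rw [ketbra_mul_diag_apply hj]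
  have : unary K s = unary K t ↔ s = t := ⟨unary_injOn K hs ht, fun h => by rw [h]⟩
  congr 1
  rw [eq_iff_iff, this]
  rfl

/-- Raising two adjacent clock bits advances a legal clock by two steps. -/
theorem ketbra_mul_up_unary {K s t : ℕ} (hs : s ≤ K) (ht : t ≤ K) {j j' : Fin K}
    (hj : (j' : ℕ) = j + 1) :
    (ketbra j true false * ketbra j' true false) (unary K s) (unary K t) =
      if s = (j : ℕ) + 2 ∧ t = (j : ℕ) then 1 else 0 := by
  have hne : j ≠ j' := by rintro rfl; omega
  rw [ketbra, ketbra, onQubit_mul_apply hne]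
  have hj' := j'.2
  by_cases h : s = (j : ℕ) + 2 ∧ t = (j : ℕ)
  · rw [if_pos h, if_pos]
    · obtain ⟨rfl, rfl⟩ := h
      have : (j : ℕ) < j + 2 := by omega
      simp [unary, hj]
    · intro r h1 h2
      rw [Ne, Fin.ext_iff] at h1 h2
      simp only [unary, decide_eq_decide]
      omega
  · rw [if_neg h]
    split_ifs with hr
    · by_contra hne
      rw [mul_eq_zero, not_or, Matrix.single_apply, Matrix.single_apply] at hne
      have h1 := (ite_ne_right_iff.1 hne.1).1
      have h2 := (ite_ne_right_iff.1 hne.2).1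
      simp only [unary, eq_comm (a := true), eq_comm (a := false), decide_eq_true_eq,
        decide_eq_false_iff_not] at h1 h2
      apply h
      simp only [unary, decide_eq_decide, Ne, Fin.ext_iff] at hr
      have ht' : ¬ t < (j : ℕ) := fun hlt => by
        have := hr ⟨t, by omega⟩ (by simp; omega) (by simp; omega)
        simp at this; omega
      have hs' : ¬ (j : ℕ) + 2 < s := fun hlt => by
        have := hr ⟨s - 1, by omega⟩ (by simp; omega) (by simp; omega)
        simp at this; omega
      omega
    · rfl

theorem ketbra_mul_down_unary {K s t : ℕ} (hs : s ≤ K) (ht : t ≤ K) {j j' : Fin K}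
    (hj : (j' : ℕ) = j + 1) :
    (ketbra j false true * ketbra j' false true) (unary K s) (unary K t) =
      if s = (j : ℕ) ∧ t = (j : ℕ) + 2 then 1 else 0 := by
  have hne : j ≠ j' := by rintro rfl; omega
  have e : ketbra j false true * ketbra j' false true =
      (ketbra j true false * ketbra j' true false).conjTranspose := by
    simp only [ketbra, onQubit_mul_conjTranspose hne, conjTranspose_single_one]
  rw [e, Matrix.conjTranspose_apply, ketbra_mul_up_unary ht hs hj]
  simp only [and_comm (a := t = _)]
  split_ifs <;> simp

/-! ### Tensor products of register and clock operators -/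

/-- The operator `R ⊗ A` with `R` on the register and `A` on the clock. -/
def tens {N K : ℕ} (R : QOp (Fin N)) (A : QOp (Fin K)) : QOp (Qubits N K) :=
  Matrix.of fun x y => R (x ∘ Sum.inl) (y ∘ Sum.inl) * A (x ∘ Sum.inr) (y ∘ Sum.inr)

theorem tens_elim {N K : ℕ} (R : QOp (Fin N)) (A : QOp (Fin K)) (a b : Fin N → Bool)
    (c d : Fin K → Bool) : tens R A (Sum.elim a c) (Sum.elim b d) = R a b * A c d := rfl

theorem sum_qubits {N K : ℕ} {β : Type*} [AddCommMonoid β] (f : (Qubits N K → Bool) → β) :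
    ∑ x, f x = ∑ a : Fin N → Bool, ∑ c : Fin K → Bool, f (Sum.elim a c) := by
  rw [← (Equiv.sumArrowEquivProdArrow (Fin N) (Fin K) Bool).symm.sum_comp, Fintype.sum_prod_type]
  rfl

theorem tens_mul {N K : ℕ} (R R' : QOp (Fin N)) (A A' : QOp (Fin K)) :
    tens R A * tens R' A' = tens (R * R') (A * A') := by
  ext x y
  rw [Matrix.mul_apply, sum_qubits]
  simp only [tens, Matrix.of_apply, Matrix.mul_apply, Finset.sum_mul_sum]
  refine Finset.sum_congr rfl fun a _ => Finset.sum_congr rfl fun c _ => ?_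
  simp only [Sum.elim_comp_inl, Sum.elim_comp_inr]
  ring

theorem tens_one_one {N K : ℕ} : tens (1 : QOp (Fin N)) (1 : QOp (Fin K)) = 1 := by
  ext x y
  simp only [tens, Matrix.of_apply, Matrix.one_apply]
  by_cases h : x = y
  · simp [h]
  · rw [if_neg h]
    split_ifs with h1 h2
    · exact absurd (funext fun r => by
        rcases r with r | r
        · exact congrFun h1 r
        · exact congrFun h2 r) h
    all_goals simp

theorem onQubit_inl {N K : ℕ} (q : Fin N) (A : Matrix Bool Bool ℂ) :
    (onQubit (.inl q) A : QOp (Qubits N K)) = tens (onQubit q A) 1 := by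
  ext x y
  simp only [tens, Matrix.of_apply, onQubit_apply, Matrix.one_apply, Sum.forall, funext_iff]
  by_cases h : ∀ r, r ≠ q → x (.inl r) = y (.inl r) <;>
    by_cases h' : ∀ r, x (.inr r) = y (.inr r) <;> simp [h, h']

theorem onQubit_inr {N K : ℕ} (q : Fin K) (A : Matrix Bool Bool ℂ) :
    (onQubit (.inr q) A : QOp (Qubits N K)) = tens 1 (onQubit q A) := by
  ext x y
  simp only [tens, Matrix.of_apply, onQubit_apply, Matrix.one_apply, Sum.forall, funext_iff]
  by_cases h : ∀ r, r ≠ q → x (.inr r) = y (.inr r) <;>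
    by_cases h' : ∀ r, x (.inl r) = y (.inl r) <;> simp [h, h']

theorem czOp_inl {N K : ℕ} (f s : Fin N) :
    (czOp (.inl f) (.inl s) : QOp (Qubits N K)) = tens (czOp f s) 1 := by
  ext x y
  simp only [tens, Matrix.of_apply, czOp, Matrix.one_apply, Matrix.diagonal_apply]
  by_cases h : x = y
  · simp [h]
  · rw [if_neg h]
    by_cases h1 : x ∘ Sum.inl = y ∘ Sum.inl
    · rw [if_neg (c := x ∘ Sum.inr = y ∘ Sum.inr), mul_zero]
      intro h2
      exact h (funext fun r => by
        rcases r with r | r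
        · exact congrFun h1 r
        · exact congrFun h2 r)
    · rw [if_neg h1, zero_mul]

/-! ### States with legal clock -/

section Legal

variable {N K : ℕ}

/-- The register part of a state at clock time `t`. -/
def slice (v : QState (Qubits N K)) (t : ℕ) : QState (Fin N) :=
  WithLp.toLp 2 fun a => v (Sum.elim a (unary K t))

@[simp] theorem slice_apply (v : QState (Qubits N K)) (t : ℕ) (a : Fin N → Bool) :
    slice v t a = v (Sum.elim a (unary K t)) := rfl

/-- The states supported on unary clock states. -/
def legal (N K : ℕ) : Submodule ℂ (QState (Qubits N K)) where
  carrier := {v | ∀ a c, (∀ t ≤ K, c ≠ unary K t) → v (Sum.elim a c) = 0}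
  add_mem' := by
    intro v w hv hw a c h
    simp [hv a c h, hw a c h]
  zero_mem' := by intro a c _; simp
  smul_mem' := by
    intro k v hv a c h
    simp [hv a c h]

/-- Distinct times up to `K` have distinct unary strings, so a sum over clock strings that vanishes
off the unary ones is a sum over times. -/
theorem sum_legal {β : Type*} [AddCommMonoid β] (f : (Qubits N K → Bool) → β)
    (hf : ∀ a c, (∀ t ≤ K, c ≠ unary K t) → f (Sum.elim a c) = 0) :
    ∑ x, f x = ∑ t ∈ Finset.range (K + 1), ∑ a, f (Sum.elim a (unary K t)) := by
  rw [sum_qubits, Finset.sum_comm (s := Finset.range (K + 1))]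
  refine Finset.sum_congr rfl fun a _ => ?_
  symm
  apply Finset.sum_of_injOn (unary K)
  · intro s hs t ht h
    simp only [Finset.coe_range, Set.mem_Iio] at hs ht
    exact unary_injOn K (by omega) (by omega) h
  · simp
  · intro c _ hc
    apply hf
    intro t ht h
    exact hc ⟨t, by simp; omega, h.symm⟩
  · intros; rfl

theorem norm_sq_legal {v : QState (Qubits N K)} (hv : v ∈ legal N K) :
    ‖v‖ ^ 2 = ∑ t ∈ Finset.range (K + 1), ‖slice v t‖ ^ 2 := by
  simp only [EuclideanSpace.norm_sq_eq]
  rw [sum_legal]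
  · rfl
  · intro a c h
    rw [hv a c h]; simp

theorem sesq_eq_sum {Q : Type} [Fintype Q] [DecidableEq Q] (A : QOp Q) (v w : QState Q) :
    sesq A v w = ∑ x, ∑ y, star (v x) * A x y * w y := by
  rw [sesq, PiLp.inner_apply]
  refine Finset.sum_congr rfl fun x _ => ?_
  rw [applyOp_apply, inner_sum]
  refine Finset.sum_congr rfl fun y _ => ?_
  simp; ring

theorem sesq_tens {v w : QState (Qubits N K)} (hv : v ∈ legal N K) (hw : w ∈ legal N K)
    (R : QOp (Fin N)) (A : QOp (Fin K)) :
    sesq (tens R A) v w = ∑ s ∈ Finset.range (K + 1), ∑ t ∈ Finset.range (K + 1),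
      A (unary K s) (unary K t) * sesq R (slice v s) (slice w t) := by
  rw [sesq_eq_sum, sum_legal]
  · refine Finset.sum_congr rfl fun s _ => ?_
    simp only [sesq_eq_sum, Finset.mul_sum]
    rw [Finset.sum_comm (s := Finset.range (K + 1))]
    refine Finset.sum_congr rfl fun a _ => ?_
    rw [sum_legal]
    · refine Finset.sum_congr rfl fun t _ => Finset.sum_congr rfl fun b _ => ?_
      rw [tens_elim, slice_apply, slice_apply]
      ring
    · intro b c h
      rw [hw b c h, mul_zero]
  · intro a c h
    simp [hv a c h]

/-- All clock operators of the Hamiltonian other than the clock penalty are sums of operators with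
one nonzero entry between legal clock states, so this turns energies into inner products of slices.
-/
theorem sesq_tens_single {v w : QState (Qubits N K)} (hv : v ∈ legal N K) (hw : w ∈ legal N K)
    (R : QOp (Fin N)) (A : QOp (Fin K)) {s₀ t₀ : ℕ} (hs : s₀ ≤ K) (ht : t₀ ≤ K)
    (hA : ∀ s ≤ K, ∀ t ≤ K, A (unary K s) (unary K t) = if s = s₀ ∧ t = t₀ then 1 else 0) :
    sesq (tens R A) v w = sesq R (slice v s₀) (slice w t₀) := by
  rw [sesq_tens hv hw, Finset.sum_eq_single s₀, Finset.sum_eq_single t₀]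
  · rw [hA _ hs _ ht]; simp
  · intro t h hne
    rw [hA _ hs _ (by simp at h; omega), if_neg (by tauto), zero_mul]
  · intro h; simp at h; omega
  · intro s h hne
    refine Finset.sum_eq_zero fun t h' => ?_
    rw [hA _ (by simp at h; omega) _ (by simp at h'; omega), if_neg (by tauto), zero_mul]
  · intro h; simp at h; omega

theorem clockKB_eq_tens {t : ℕ} (h1 : 1 ≤ t) (h2 : t ≤ K) (a b : Bool) :
    clockKB N K t a b = tens 1 (ketbra ⟨t - 1, by omega⟩ a b) := by
  rw [clockKB, dif_pos ⟨h1, h2⟩, ketbra, onQubit_inr, ketbra]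

variable {v w : QState (Qubits N K)}

theorem sesq_clockKB_up (hv : v ∈ legal N K) (hw : w ∈ legal N K) (R : QOp (Fin N)) {t : ℕ}
    (h1 : 1 ≤ t) (h2 : t ≤ K) :
    sesq (tens R 1 * clockKB N K t true false) v w = sesq R (slice v t) (slice w (t - 1)) := by
  rw [clockKB_eq_tens h1 h2, tens_mul, mul_one, one_mul]
  refine sesq_tens_single hv hw R _ h2 (by omega) fun s hs t' ht' => ?_
  rw [ketbra_unary_up hs ht']
  simp only [show t - 1 + 1 = t by omega]

theorem sesq_clockKB_down (hv : v ∈ legal N K) (hw : w ∈ legal N K) (R : QOp (Fin N)) {t : ℕ}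
    (h1 : 1 ≤ t) (h2 : t ≤ K) :
    sesq (tens R 1 * clockKB N K t false true) v w = sesq R (slice v (t - 1)) (slice w t) := by
  rw [clockKB_eq_tens h1 h2, tens_mul, mul_one, one_mul]
  refine sesq_tens_single hv hw R _ (by omega) h2 fun s hs t' ht' => ?_
  rw [ketbra_unary_down hs ht']
  simp only [show t - 1 + 1 = t by omega]

theorem sesq_clockKB_last (hv : v ∈ legal N K) (hw : w ∈ legal N K) (R : QOp (Fin N))
    (h : 1 ≤ K) :
    sesq (tens R 1 * clockKB N K K true true) v w = sesq R (slice v K) (slice w K) := by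
  rw [clockKB_eq_tens h le_rfl, tens_mul, mul_one, one_mul]
  refine sesq_tens_single hv hw R _ le_rfl le_rfl fun s hs t' ht' => ?_
  rw [ketbra_unary_diag hs ht']
  congr 1
  simp only [decide_eq_true_eq, eq_iff_iff]
  omega

theorem sesq_clockKB_first (hv : v ∈ legal N K) (hw : w ∈ legal N K) (R : QOp (Fin N))
    (h : 1 ≤ K) :
    sesq (tens R 1 * clockKB N K 1 false false) v w = sesq R (slice v 0) (slice w 0) := by
  rw [clockKB_eq_tens le_rfl h, tens_mul, mul_one, one_mul]
  refine sesq_tens_single hv hw R _ (by omega) (by omega) fun s hs t' ht' => ?_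
  rw [ketbra_unary_diag hs ht']
  congr 1
  simp only [decide_eq_false_iff_not, eq_iff_iff]
  omega

/-- A unary string has the pattern 10 at positions `t`, `t + 1` precisely when it encodes time `t`.
-/
theorem sesq_clock10 (hv : v ∈ legal N K) (hw : w ∈ legal N K) {t : ℕ}
    (h1 : 1 ≤ t) (h2 : t + 1 ≤ K) :
    sesq (clock10 N K t) v w = inner ℂ (slice v t) (slice w t) := by
  rw [clock10, clockKB_eq_tens h1 (by omega), clockKB_eq_tens (by omega) h2, tens_mul, mul_one,
    sesq_tens_single hv hw 1 _ (s₀ := t) (t₀ := t) (by omega) (by omega), sesq, applyOp_one]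
  intro s hs t' ht'
  rw [ketbra_mul_diag_unary hs ht' (by rw [Ne, Fin.ext_iff]; simp; omega)]
  congr 1
  simp only [decide_eq_true_eq, decide_eq_false_iff_not, eq_iff_iff]
  omega

theorem sesq_clockX (hv : v ∈ legal N K) (hw : w ∈ legal N K) (R : QOp (Fin N)) {t : ℕ}
    (h1 : 1 ≤ t) (h2 : t ≤ K) :
    sesq (tens R 1 * clockX N K t) v w =
      sesq R (slice v t) (slice w (t - 1)) + sesq R (slice v (t - 1)) (slice w t) := by
  rw [clockX, mul_add, sesq_add, sesq_clockKB_up hv hw R h1 h2, sesq_clockKB_down hv hw R h1 h2]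

theorem sesq_clockXX (hv : v ∈ legal N K) (hw : w ∈ legal N K) {t : ℕ}
    (h1 : 1 ≤ t) (h2 : t + 1 ≤ K) :
    sesq (clockXX N K t) v w = inner ℂ (slice v (t + 1)) (slice w (t - 1)) +
      inner ℂ (slice v (t - 1)) (slice w (t + 1)) := by
  rw [clockXX, sesq_add]
  simp only [clockKB_eq_tens h1 (show t ≤ K by omega), clockKB_eq_tens (show 1 ≤ t + 1 by omega) h2,
    tens_mul, mul_one]
  rw [sesq_tens_single hv hw 1 _ (s₀ := t + 1) (t₀ := t - 1) (by omega) (by omega),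
    sesq_tens_single hv hw 1 _ (s₀ := t - 1) (t₀ := t + 1) (by omega) (by omega)]
  · simp only [sesq, applyOp_one]
  · intro s hs t' ht'
    rw [ketbra_mul_down_unary hs ht' (by simp; omega)]
    simp only [show t - 1 + 2 = t + 1 by omega]
  · intro s hs t' ht'
    rw [ketbra_mul_up_unary hs ht' (by simp; omega)]
    simp only [show t - 1 + 2 = t + 1 by omega]

end Legal

/-! ### The clock term -/

section ClockTerm

variable {N K : ℕ}

theorem exists_eq_unary (c : Fin K → Bool)
    (h : ∀ (j : ℕ) (hj : j + 1 < K), c ⟨j + 1, hj⟩ = true → c ⟨j, by omega⟩ = true) :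
    ∃ t ≤ K, c = unary K t := by
  -- The time is the position of the first zero; the condition is vacuous at `K`, which covers the
  -- all-ones string.
  have hex : ∃ j, ∀ hj : j < K, c ⟨j, hj⟩ = false := ⟨K, fun hj => by omega⟩
  classical
  refine ⟨Nat.find hex, Nat.find_min' hex fun hj => by omega, funext fun j => ?_⟩
  rw [unary, eq_comm]
  by_cases hj : (j : ℕ) < Nat.find hex
  · have := Nat.find_min hex hj
    push Not at this
    obtain ⟨_, h1⟩ := this
    simpa [hj] using (Bool.eq_true_of_not_eq_false h1).symm
  · have key : ∀ i, Nat.find hex ≤ i → ∀ hi : i < K, c ⟨i, hi⟩ = false := by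
      intro i hi
      induction i, hi using Nat.le_induction with
      | base => exact Nat.find_spec hex
      | succ i _ ih =>
        intro hi'
        by_contra hne
        have := h i hi' (Bool.eq_true_of_not_eq_false hne)
        rw [ih (by omega)] at this
        cases this
    rw [key j (by omega) j.2]
    simp [hj]

theorem energy_diag {Q : Type} [Fintype Q] [DecidableEq Q] {A : QOp Q} {P : (Q → Bool) → Prop}
    [DecidablePred P] (hA : ∀ a b, A a b = if a = b ∧ P a then 1 else 0) (v : QState Q) :
    energy A v = ∑ a, if P a then ‖v a‖ ^ 2 else 0 := by
  rw [energy, sesq_eq_sum, Complex.re_sum]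
  refine Finset.sum_congr rfl fun a _ => ?_
  rw [Finset.sum_eq_single a]
  · rw [hA]
    split_ifs with h1 h2 h2
    · rw [mul_one, mul_comm, Complex.star_def, Complex.mul_conj, Complex.ofReal_re,
        Complex.normSq_eq_norm_sq]
    · tauto
    · tauto
    · simp
  · intro b _ hb
    rw [hA, if_neg (by tauto)]
    simp
  · simp

theorem energy_ketbra {Q : Type} [Fintype Q] [DecidableEq Q] (q : Q) (α : Bool) (v : QState Q) :
    energy (ketbra q α α) v = ∑ a, if a q = α then ‖v a‖ ^ 2 else 0 := by
  refine energy_diag (fun a b => ?_) v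
  rw [ketbra_apply]
  congr 1
  rw [eq_iff_iff]
  constructor
  · rintro ⟨h, h1, h2⟩
    refine ⟨funext fun r => ?_, h1⟩
    by_cases hr : r = q
    · rw [hr, h1, h2]
    · exact h r hr
  · rintro ⟨rfl, h⟩
    exact ⟨fun r _ => rfl, h, h⟩

theorem energy_HClock (v : QState (Qubits N K)) :
    energy (HClock N K) v = ∑ x, ∑ j ∈ Finset.Icc 1 (K - 1),
      if ∃ h : 1 ≤ j ∧ j < K, x (.inr ⟨j - 1, by omega⟩) = false ∧ x (.inr ⟨j, h.2⟩) = true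
        then ‖v x‖ ^ 2 else 0 := by
  rw [HClock, energy_sum, Finset.sum_comm]
  refine Finset.sum_congr rfl fun j hj => ?_
  rw [Finset.mem_Icc] at hj
  refine energy_diag (fun a b => ?_) v
  rw [clockKB, dif_pos ⟨hj.1, by omega⟩, clockKB, dif_pos ⟨by omega, by omega⟩,
    ketbra_mul_diag_apply (by simp; omega)]
  congr 1
  rw [eq_iff_iff]
  refine and_congr_right fun _ => ⟨fun h => ⟨⟨hj.1, by omega⟩, h⟩, fun ⟨_, h⟩ => h⟩

theorem energy_HClock_legal {v : QState (Qubits N K)} (hv : v ∈ legal N K) :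
    energy (HClock N K) v = 0 := by
  rw [energy_HClock, sum_legal]
  · refine Finset.sum_eq_zero fun t _ => Finset.sum_eq_zero fun a _ =>
      Finset.sum_eq_zero fun j _ => if_neg ?_
    rintro ⟨h, h1, h2⟩
    simp [unary] at h1 h2
    omega
  · intro a c h
    simp [hv a c h]

/-- Deleting all components with a non-unary clock leaves a legal state, and each deleted string
contains the pattern 01 at least once. Hence the constant is 1. -/
theorem exists_legal_near (v : QState (Qubits N K)) :
    ∃ u ∈ legal N K, ‖v - u‖ ^ 2 ≤ 1 * energy (HClock N K) v := by
  classical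
  refine ⟨WithLp.toLp 2 fun x => if ∃ t ≤ K, x ∘ Sum.inr = unary K t then v x else 0, ?_, ?_⟩
  · intro a c h
    refine if_neg ?_
    rintro ⟨t, ht, hc⟩
    exact h t ht hc
  · rw [one_mul, energy_HClock, EuclideanSpace.norm_sq_eq]
    refine Finset.sum_le_sum fun x _ => ?_
    simp only [PiLp.sub_apply]
    split_ifs with h
    · simp only [sub_self, norm_zero]
      rw [zero_pow two_ne_zero]
      exact Finset.sum_nonneg fun j _ => by split_ifs <;> positivity
    · rw [sub_zero]
      have : ∃ (j : ℕ) (hj : j + 1 < K), x (.inr ⟨j, by omega⟩) = false ∧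
          x (.inr ⟨j + 1, hj⟩) = true := by
        by_contra! hne
        exact h (exists_eq_unary (x ∘ Sum.inr) fun j hj h1 => by
          by_contra h2
          exact hne j hj (by simpa using h2) h1)
      obtain ⟨j, hj, h1, h2⟩ := this
      refine le_trans ?_ (Finset.single_le_sum (fun j _ => ?_)
        (Finset.mem_Icc.2 ⟨show 1 ≤ j + 1 by omega, by omega⟩))
      · rw [if_pos ⟨⟨by omega, hj⟩, h1, h2⟩]
      · split_ifs <;> positivity

end ClockTerm

/-! ### The gates on the register -/

/-- A gate as an operator on the register. -/
def Gate.reg {N : ℕ} : Gate N → QOp (Fin N)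
  | Gate.one q u => onQubit q (u : Matrix Bool Bool ℂ)
  | Gate.cz f s _ => czOp f s

theorem Gate.op_eq_tens {N : ℕ} (K : ℕ) (g : Gate N) : g.op K = tens g.reg 1 := by
  cases g
  · exact onQubit_inl _ _
  · exact czOp_inl _ _

theorem Gate.reg_unitary {N : ℕ} (g : Gate N) : g.reg.conjTranspose * g.reg = 1 := by
  cases g
  · exact onQubit_unitary _ _
  · exact czOp_unitary _ _

theorem Gate.IsZ.reg_eq {N : ℕ} {g : Gate N} {q : Fin N} (h : g.IsZ q) :
    g.reg = onQubit q pauliZ := by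
  obtain ⟨u, rfl, hu⟩ := h
  rw [Gate.reg, hu]

theorem tens_conjTranspose {N K : ℕ} (R : QOp (Fin N)) (A : QOp (Fin K)) :
    (tens R A).conjTranspose = tens R.conjTranspose A.conjTranspose := by
  ext x y
  simp [tens]

namespace RegularCircuit

variable {N : ℕ} (C : RegularCircuit N) (M : ℕ)

/-- The gate of the idled circuit at time `t`, as an operator on the register. -/
def regGate (t : ℕ) : QOp (Fin N) := if t ≤ M then 1 else (C.gate (t - M)).reg

theorem idled_eq_tens (K t : ℕ) : C.idled M K t = tens (C.regGate M t) 1 := by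
  rw [idled, regGate]
  split_ifs
  · exact tens_one_one.symm
  · exact Gate.op_eq_tens _ _

theorem regGate_unitary (t : ℕ) : (C.regGate M t).conjTranspose * C.regGate M t = 1 := by
  rw [regGate]
  split_ifs
  · simp
  · exact Gate.reg_unitary _

variable {M}

/-- The two projectors and the two transitions are the terms of an expanded square; unitarity of the
gate gives the norm of the propagated slice. The boundary variants of the projectors select times
`C.T + M` and 0. -/
theorem energy_HPropAt {v : QState (Qubits N (C.T + M))} (hv : v ∈ legal N (C.T + M)) {t : ℕ}
    (ht : t ∈ Finset.Icc 1 (C.T + M)) :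
    energy (C.HPropAt M t) v =
      1 / 2 * ‖slice v t - applyOp (C.regGate M t) (slice v (t - 1))‖ ^ 2 := by
  rw [Finset.mem_Icc] at ht
  have h1 : sesq (if t = C.T + M then clockKB N (C.T + M) (C.T + M) true true
      else clock10 N (C.T + M) t) v v = inner ℂ (slice v t) (slice v t) := by
    split_ifs with h
    · have := sesq_clockKB_last hv hv 1 (by omega)
      rw [tens_one_one, one_mul] at this
      rw [this, sesq, applyOp_one, show slice v t = slice v (C.T + M) by rw [h]]
    · exact sesq_clock10 hv hv ht.1 (by omega)
  have h2 : sesq (if t = 1 then clockKB N (C.T + M) 1 false false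
      else clock10 N (C.T + M) (t - 1)) v v = inner ℂ (slice v (t - 1)) (slice v (t - 1)) := by
    split_ifs with h
    · have := sesq_clockKB_first hv hv 1 (by omega)
      rwa [tens_one_one, one_mul, sesq, sesq, applyOp_one, ← sesq, show 0 = t - 1 by omega] at this
    · exact sesq_clock10 hv hv (by omega) (by omega)
  have h3 := sesq_clockKB_up hv hv (C.regGate M t) ht.1 ht.2
  have h4 := sesq_clockKB_down hv hv (C.regGate M t).conjTranspose ht.1 ht.2
  rw [energy, HPropAt]
  simp only [idled_eq_tens, tens_conjTranspose, Matrix.conjTranspose_one]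
  rw [sesq_smul, sesq_sub, sesq_sub, sesq_add, h1, h2, h3, h4, sesq, sesq, ← inner_applyOp_left,
    @norm_sub_sq ℂ, norm_applyOp_isometry _ (C.regGate_unitary M t),
    inner_self_eq_norm_sq_to_K,
    inner_self_eq_norm_sq_to_K]
  have e : (1 / 2 : ℂ) = ((1 / 2 : ℝ) : ℂ) := by simp
  rw [e, Complex.re_ofReal_mul]
  have h5 := inner_re_symm (𝕜 := ℂ) (slice v t) (applyOp (C.regGate M t) (slice v (t - 1)))
  simp only [RCLike.re_to_complex] at h5
  simp [← Complex.ofReal_pow, h5]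
  ring

end RegularCircuit

/-! ### The controlled-`Z` terms -/

theorem applyOp_onQubit_pauliZ {N : ℕ} (q : Fin N) (v : QState (Fin N)) (a : Fin N → Bool) :
    applyOp (onQubit q pauliZ) v a = (if a q then -1 else 1) * v a := by
  rw [applyOp_apply, sum_onQubit_mul, Finset.sum_eq_single (a q)]
  · simp [pauliZ]
  · intro β _ h
    simp [pauliZ, Matrix.diagonal_apply_ne _ h.symm]
  · simp

theorem applyOp_ketbra_diag {N : ℕ} (q : Fin N) (α : Bool) (v : QState (Fin N))
    (a : Fin N → Bool) :
    applyOp (ketbra q α α) v a = if a q = α then v a else 0 := by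
  rw [applyOp_apply, ketbra, sum_onQubit_mul, Finset.sum_eq_single (a q)]
  · simp [Matrix.single_apply, eq_comm]
  · intro β _ h
    rw [Matrix.single_apply, if_neg, zero_mul]
    rintro ⟨rfl, rfl⟩
    exact h rfl
  · simp

theorem applyOp_czOp {N : ℕ} (f s : Fin N) (v : QState (Fin N)) (a : Fin N → Bool) :
    applyOp (czOp f s) v a = (if a f && a s then -1 else 1) * v a := by
  rw [applyOp_apply, czOp, Finset.sum_eq_single a]
  · simp
  · intro b _ h
    rw [Matrix.diagonal_apply_ne _ h.symm, zero_mul]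
  · simp

namespace RegularCircuit

variable {N : ℕ} (C : RegularCircuit N) (M : ℕ)

variable {M}

theorem regGate_of_le {t : ℕ} (ht : M < t) : C.regGate M t = (C.gate (t - M)).reg := by
  rw [regGate, if_neg (by omega)]

/-- The neighbourhood of a controlled-`Z` gate. -/
theorem czTimes_spec {t : ℕ} (ht : t ∈ C.czTimes M) : ∃ f s : Fin N, ∃ hfs : f ≠ s,
    C.gate (t - M) = .cz f s hfs ∧ C.regGate M t = czOp f s ∧
    C.regGate M (t - 2) = onQubit f pauliZ ∧ C.regGate M (t - 1) = onQubit s pauliZ ∧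
    C.regGate M (t + 1) = onQubit f pauliZ ∧ C.regGate M (t + 2) = onQubit s pauliZ ∧
    M + 5 ≤ t ∧ t + 4 ≤ C.T + M ∧ (∀ i ∈ Finset.Icc 1 4, t + i ∉ C.czTimes M ∧
      t - i ∉ C.czTimes M) := by
  obtain ⟨l, h1, h2, rfl⟩ := (C.mem_czTimes M).1 ht
  obtain ⟨f, s, hfs, hg, h3, h4, h5, h6⟩ := C.gate_cz l h1 h2
  have hL := C.five_le_L
  have hl : C.L ≤ l * C.L := Nat.le_mul_of_pos_left _ (by omega)
  have hT : l * C.L + C.L ≤ C.T₂ * C.L + C.L := by gcongr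
  have hTT : C.T = C.T₂ * C.L + C.L - 1 := by rw [T, add_mul, one_mul]
  have e0 : l * C.L + M - M = l * C.L := by omega
  have e1 : l * C.L + M - 2 - M = l * C.L - 2 := by omega
  have e2 : l * C.L + M - 1 - M = l * C.L - 1 := by omega
  have e3 : l * C.L + M + 1 - M = l * C.L + 1 := by omega
  have e4 : l * C.L + M + 2 - M = l * C.L + 2 := by omega
  refine ⟨f, s, hfs, by rw [e0, hg], ?_, ?_, ?_, ?_, ?_, by omega, by omega, fun i hi => ?_⟩
  · rw [C.regGate_of_le (by omega), e0, hg]; rfl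
  · rw [C.regGate_of_le (by omega), e1, h3.reg_eq]
  · rw [C.regGate_of_le (by omega), e2, h4.reg_eq]
  · rw [C.regGate_of_le (by omega), e3, h5.reg_eq]
  · rw [C.regGate_of_le (by omega), e4, h6.reg_eq]
  · rw [Finset.mem_Icc] at hi
    -- Distinct multiples of `C.L` differ by at least `C.L ≥ 5`; stated with products as atoms so
    -- that linear arithmetic can use it.
    have key : ∀ l', l' * C.L ≤ l * C.L ∧ l' * C.L + C.L ≤ l * C.L ∨ l' = l ∨
        l * C.L + C.L ≤ l' * C.L := by
      intro l'
      rcases lt_trichotomy l' l with h | h | h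
      · left
        have : (l' + 1) * C.L ≤ l * C.L := Nat.mul_le_mul_right _ h
        rw [add_mul, one_mul] at this
        omega
      · exact .inr (.inl h)
      · right; right
        have : (l + 1) * C.L ≤ l' * C.L := Nat.mul_le_mul_right _ h
        rwa [add_mul, one_mul] at this
    constructor
    · rw [mem_czTimes]
      rintro ⟨l', -, -, h⟩
      rcases key l' with h' | rfl | h' <;> omega
    · rw [mem_czTimes]
      rintro ⟨l', -, -, h⟩
      rcases key l' with h' | rfl | h' <;> omega

/-- The legal states that are propagated correctly at all times outside of `bad`. -/
def propagating (M : ℕ) (bad : Finset ℕ) : Submodule ℂ (QState (Qubits N (C.T + M))) where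
  carrier := {v | v ∈ legal N (C.T + M) ∧ ∀ t ∈ Finset.Icc 1 (C.T + M) \ bad,
    slice v t = applyOp (C.regGate M t) (slice v (t - 1))}
  add_mem' := by
    rintro v w ⟨hv, hv'⟩ ⟨hw, hw'⟩
    refine ⟨add_mem hv hw, fun t ht => ?_⟩
    have e : ∀ t, slice (v + w) t = slice v t + slice w t := fun t => by ext; simp
    rw [e, e, hv' t ht, hw' t ht, applyOp_vec_add]
  zero_mem' := by
    refine ⟨zero_mem _, fun t _ => ?_⟩
    have e : ∀ t, slice (0 : QState (Qubits N (C.T + M))) t = 0 := fun t => by ext; simp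
    rw [e, e, applyOp_vec_zero]
  smul_mem' := by
    rintro c v ⟨hv, hv'⟩
    refine ⟨Submodule.smul_mem _ c hv, fun t ht => ?_⟩
    have e : ∀ t, slice (c • v) t = c • slice v t := fun t => by ext; simp
    rw [e, e, hv' t ht, applyOp_vec_smul]

variable {v : QState (Qubits N (C.T + M))}

theorem sesq_HTimeAt (hv : v ∈ legal N (C.T + M)) {t : ℕ} (h1 : 4 ≤ t) (h2 : t + 3 ≤ C.T + M) :
    sesq (C.HTimeAt M t) v v = 1 / 8 *
      (inner ℂ (slice v t) (slice v t) + 6 * inner ℂ (slice v (t + 1)) (slice v (t + 1)) +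
        inner ℂ (slice v (t + 2)) (slice v (t + 2)) +
        2 * (inner ℂ (slice v (t + 2)) (slice v t) + inner ℂ (slice v t) (slice v (t + 2))) +
        (inner ℂ (slice v (t + 1)) (slice v t) + inner ℂ (slice v t) (slice v (t + 1))) +
        (inner ℂ (slice v (t + 2)) (slice v (t + 1)) +
          inner ℂ (slice v (t + 1)) (slice v (t + 2))) +
        inner ℂ (slice v (t - 3)) (slice v (t - 3)) +
        6 * inner ℂ (slice v (t - 2)) (slice v (t - 2)) +
        inner ℂ (slice v (t - 1)) (slice v (t - 1)) +
        2 * (inner ℂ (slice v (t - 1)) (slice v (t - 3)) +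
          inner ℂ (slice v (t - 3)) (slice v (t - 1))) +
        (inner ℂ (slice v (t - 2)) (slice v (t - 3)) +
          inner ℂ (slice v (t - 3)) (slice v (t - 2))) +
        (inner ℂ (slice v (t - 1)) (slice v (t - 2)) +
          inner ℂ (slice v (t - 2)) (slice v (t - 1)))) := by
  have hP : ∀ j, 1 ≤ j → j + 1 ≤ C.T + M → sesq (clock10 N (C.T + M) j) v v =
      inner ℂ (slice v j) (slice v j) := fun j h h' => sesq_clock10 hv hv h h'
  have hX : ∀ j, 1 ≤ j → j ≤ C.T + M → sesq (clockX N (C.T + M) j) v v =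
      inner ℂ (slice v j) (slice v (j - 1)) + inner ℂ (slice v (j - 1)) (slice v j) := by
    intro j h h'
    have := sesq_clockX hv hv 1 h h'
    rwa [tens_one_one, one_mul, sesq.eq_def 1, sesq.eq_def 1, applyOp_one, applyOp_one] at this
  have hY : ∀ j, 1 ≤ j → j + 1 ≤ C.T + M → sesq (clockXX N (C.T + M) j) v v =
      inner ℂ (slice v (j + 1)) (slice v (j - 1)) +
        inner ℂ (slice v (j - 1)) (slice v (j + 1)) := fun j h h' => sesq_clockXX hv hv h h'
  rw [HTimeAt]
  simp only [sesq_smul, sesq_add]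
  rw [hP t (by omega) (by omega), hP (t + 1) (by omega) (by omega),
    hP (t + 2) (by omega) (by omega), hP (t - 3) (by omega) (by omega),
    hP (t - 2) (by omega) (by omega), hP (t - 1) (by omega) (by omega),
    hX (t + 1) (by omega) (by omega), hX (t + 2) (by omega) (by omega),
    hX (t - 2) (by omega) (by omega), hX (t - 1) (by omega) (by omega),
    hY (t + 1) (by omega) (by omega), hY (t - 2) (by omega) (by omega)]
  simp only [show t + 1 - 1 = t by omega, show t + 2 - 1 = t + 1 by omega,
    show t - 2 - 1 = t - 3 by omega, show t - 1 - 1 = t - 2 by omega,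
    show t - 2 + 1 = t - 1 by omega, show t + 1 + 1 = t + 2 by omega]

/-- The register part of the term `HQubitAt`. -/
def couplingOp (f s : Fin N) : QOp (Fin N) :=
  (-2 : ℂ) • ketbra f false false + (-2 : ℂ) • ketbra s false false +
    ketbra f true true + ketbra s true true

theorem sesq_HQubitAt (hv : v ∈ legal N (C.T + M)) {t : ℕ} (h1 : 1 ≤ t) (h2 : t ≤ C.T + M)
    {f s : Fin N} {hfs : f ≠ s} (hg : C.gate (t - M) = .cz f s hfs) :
    sesq (C.HQubitAt M t) v v = 1 / 2 * (sesq (couplingOp f s) (slice v t) (slice v (t - 1)) +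
      sesq (couplingOp f s) (slice v (t - 1)) (slice v t)) := by
  have e : ∀ (R R' : QOp (Fin N)), (tens (R + R') 1 : QOp (Qubits N (C.T + M))) =
      tens R 1 + tens R' 1 := by intro R R'; ext; simp [tens, add_mul]
  have e' : ∀ (c : ℂ) (R : QOp (Fin N)), (tens (c • R) 1 : QOp (Qubits N (C.T + M))) =
      c • tens R 1 := by intro c R; ext; simp [tens, mul_assoc]
  rw [HQubitAt]
  simp only [hg]
  rw [← sesq_clockX hv hv (couplingOp f s) h1 h2, smul_mul_assoc, sesq_smul, couplingOp]
  simp only [e, e', ketbra, onQubit_inl]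

/-- The Pauli gates express the six slices through two, `p` at time `t` and `q` at `t - 3`. At a
basis string with Z-signs `zf` and `zs`, the time term then gives both the weight `(8 + 4 * zf * zs
+ 2 * zf + 2 * zs) / 8`, that is 2, 1/2 or 1 for zero, one or two ones among the bits. The qubit
term supplies the cross term with this same weight and the sign of the controlled-Z gate, which
completes the square. -/
theorem energy_cz_term (hv : v ∈ C.propagating M (C.czTimes M)) {t : ℕ} (ht : t ∈ C.czTimes M) :
    ∃ f s : Fin N, energy (C.HQubitAt M t + C.HTimeAt M t) v =
      ∑ a, (if a f && a s then 1 else if a f || a s then 1 / 2 else 2) *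
        ‖(slice v t - applyOp (C.regGate M t) (slice v (t - 1))) a‖ ^ 2 := by
  obtain ⟨f, s, hfs, hg, g0, g1, g2, g3, g4, b1, b2, hbad⟩ := C.czTimes_spec ht
  refine ⟨f, s, ?_⟩
  obtain ⟨hv, hp⟩ := hv
  have hp' : ∀ j, 1 ≤ j → j ≤ C.T + M → j ∉ C.czTimes M →
      slice v j = applyOp (C.regGate M j) (slice v (j - 1)) := fun j h1 h2 h3 =>
    hp j (Finset.mem_sdiff.2 ⟨Finset.mem_Icc.2 ⟨h1, h2⟩, h3⟩)
  have k1 := hp' (t + 1) (by omega) (by omega) (hbad 1 (by simp)).1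
  have k2 := hp' (t + 2) (by omega) (by omega) (hbad 2 (by simp)).1
  have k3 := hp' (t - 1) (by omega) (by omega) (hbad 1 (by simp)).2
  have k4 := hp' (t - 2) (by omega) (by omega) (hbad 2 (by simp)).2
  rw [g3, show t + 1 - 1 = t by omega] at k1
  rw [g4, show t + 2 - 1 = t + 1 by omega, k1] at k2
  rw [g2, show t - 1 - 1 = t - 2 by omega] at k3
  rw [g1, show t - 2 - 1 = t - 3 by omega] at k4
  rw [k4] at k3
  rw [energy, sesq_add, C.sesq_HQubitAt hv (by omega) (by omega) hg,
    C.sesq_HTimeAt hv (by omega) (by omega), g0, k1, k2, k3, k4]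
  -- All gates involved are diagonal, so the identity can be checked separately at each basis
  -- string, for arbitrary `p` and `q`.
  generalize slice v t = p
  generalize slice v (t - 3) = q
  have e : ∀ (c : ℝ) (x : ℂ), c * ‖x‖ ^ 2 = ((c : ℂ) * (star x * x)).re := by
    intro c x
    rw [Complex.re_ofReal_mul, mul_comm (star x), Complex.star_def, Complex.mul_conj,
      Complex.ofReal_re, Complex.normSq_eq_norm_sq]
  simp only [e, ← Complex.re_sum]
  congr 1
  simp only [sesq, couplingOp, applyOp_add, applyOp_smul, PiLp.inner_apply, Finset.mul_sum,
    ← Finset.sum_add_distrib]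
  refine Finset.sum_congr rfl fun a _ => ?_
  simp only [PiLp.add_apply, PiLp.smul_apply, PiLp.sub_apply, applyOp_onQubit_pauliZ,
    applyOp_czOp, applyOp_ketbra_diag, RCLike.inner_apply]
  cases a f <;> cases a s <;> simp <;> ring

/-- The factor 2 is the inverse of 1/2, the smallest weight in `energy_cz_term`. -/
theorem energy_HProp2_ge (hv : v ∈ C.propagating M (C.czTimes M)) :
    ∑ t ∈ C.czTimes M, ‖slice v t - applyOp (C.regGate M t) (slice v (t - 1))‖ ^ 2 ≤
      2 * energy (C.HProp2 M) v := by
  rw [HProp2, energy_sum, Finset.mul_sum]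
  refine Finset.sum_le_sum fun t ht => ?_
  obtain ⟨f, s, h⟩ := C.energy_cz_term hv ht
  rw [h, EuclideanSpace.norm_sq_eq, Finset.mul_sum]
  refine Finset.sum_le_sum fun a _ => ?_
  rw [← mul_assoc]
  refine le_mul_of_one_le_left (by positivity) ?_
  split_ifs <;> norm_num

theorem propagating_mono {bad bad' : Finset ℕ} (h : bad ⊆ bad') :
    C.propagating M bad ≤ C.propagating M bad' := fun _ hv =>
  ⟨hv.1, fun t ht => hv.2 t (Finset.sdiff_subset_sdiff le_rfl h ht)⟩

theorem energy_HProp2_eq_zero (hv : v ∈ C.propagating M ∅) : energy (C.HProp2 M) v = 0 := by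
  rw [HProp2, energy_sum]
  refine Finset.sum_eq_zero fun t ht => ?_
  obtain ⟨f, s, h⟩ := C.energy_cz_term (C.propagating_mono (by simp) hv) ht
  obtain ⟨_, _, _, _, _, _, _, _, _, b1, b2, _⟩ := C.czTimes_spec ht
  rw [h, hv.2 t (by simp; omega)]
  simp

end RegularCircuit

/-! ### Subspaces of propagated states -/

section Slices

variable {N K : ℕ}

theorem slice_sub (v w : QState (Qubits N K)) (t : ℕ) :
    slice (v - w) t = slice v t - slice w t := by ext; simp

theorem slice_smul (c : ℂ) (v : QState (Qubits N K)) (t : ℕ) :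
    slice (c • v) t = c • slice v t := by ext; simp

theorem slice_sum {ι : Type*} (s : Finset ι) (v : ι → QState (Qubits N K)) (t : ℕ) :
    slice (∑ i ∈ s, v i) t = ∑ i ∈ s, slice (v i) t := by ext; simp

/-- The state with legal clock and the given register parts. -/
def lift (K : ℕ) (w : ℕ → QState (Fin N)) : QState (Qubits N K) :=
  WithLp.toLp 2 fun x => ∑ t ∈ Finset.range (K + 1),
    if x ∘ Sum.inr = unary K t then w t (x ∘ Sum.inl) else 0

theorem lift_mem_legal (w : ℕ → QState (Fin N)) : lift K w ∈ legal N K := by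
  intro a c h
  change (∑ t ∈ Finset.range (K + 1), if Sum.elim a c ∘ Sum.inr = unary K t
    then w t (Sum.elim a c ∘ Sum.inl) else 0) = 0
  refine Finset.sum_eq_zero fun t ht => if_neg ?_
  exact h t (by simp at ht; omega)

theorem slice_lift (w : ℕ → QState (Fin N)) {t : ℕ} (ht : t ≤ K) : slice (lift K w) t = w t := by
  ext a
  rw [slice_apply, lift]
  simp only [Sum.elim_comp_inl, Sum.elim_comp_inr]
  rw [Finset.sum_eq_single t]
  · simp
  · intro s hs hne
    exact if_neg fun h => hne (unary_injOn K ht (by simp at hs; omega) h).symm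
  · intro h; simp at h; omega

theorem inner_legal {v : QState (Qubits N K)} (hv : v ∈ legal N K) (w : QState (Qubits N K)) :
    inner ℂ v w = ∑ t ∈ Finset.range (K + 1), inner ℂ (slice v t) (slice w t) := by
  simp only [PiLp.inner_apply]
  rw [sum_legal]
  · rfl
  · intro a c h
    rw [hv a c h]; simp

theorem tens_mem_legal {v : QState (Qubits N K)} (hv : v ∈ legal N K) (R : QOp (Fin N)) :
    applyOp (tens R 1) v ∈ legal N K := by
  intro a c h
  rw [applyOp_apply]
  refine Finset.sum_eq_zero fun y _ => ?_
  rw [← Sum.elim_comp_inl_inr y, tens_elim, Matrix.one_apply]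
  split_ifs with hc
  · rw [hv _ _ (by rw [← hc]; exact h), mul_zero]
  · simp

theorem slice_tens (v : QState (Qubits N K)) (R : QOp (Fin N)) (t : ℕ) :
    slice (applyOp (tens R 1) v) t = applyOp R (slice v t) := by
  ext a
  rw [slice_apply, applyOp_apply, applyOp_apply, sum_qubits]
  refine Finset.sum_congr rfl fun b _ => ?_
  rw [Finset.sum_eq_single (unary K t)]
  · rw [tens_elim, Matrix.one_apply_eq, mul_one, slice_apply]
  · intro c _ hc
    rw [tens_elim, Matrix.one_apply_ne hc.symm, mul_zero, zero_mul]
  · simp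

end Slices

namespace RegularCircuit

variable {N : ℕ} (C : RegularCircuit N) {M : ℕ}

/-- Restart the propagation of `ψ` at the times in `bad`. -/
def restart (M : ℕ) (bad : Finset ℕ) (ψ : ℕ → QState (Fin N)) : ℕ → QState (Fin N)
  | 0 => ψ 0
  | t + 1 => if t + 1 ∈ bad then ψ (t + 1) else
      applyOp (C.regGate M (t + 1)) (restart M bad ψ t)

/-- Unitary gates carry the error along without increasing it, each step adds its own defect, and a
restart resets the error to zero. -/
theorem norm_sub_restart_le (bad : Finset ℕ) (ψ : ℕ → QState (Fin N)) (t : ℕ) :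
    ‖ψ t - C.restart M bad ψ t‖ ≤
      ∑ j ∈ Finset.Icc 1 t \ bad, ‖ψ j - applyOp (C.regGate M j) (ψ (j - 1))‖ := by
  induction t with
  | zero => simp [restart]
  | succ t ih =>
    rw [restart]
    split_ifs with h
    · rw [sub_self, norm_zero]
      positivity
    · have hIcc : Finset.Icc 1 (t + 1) \ bad = insert (t + 1) (Finset.Icc 1 t \ bad) := by
        ext j
        simp only [Finset.mem_sdiff, Finset.mem_Icc, Finset.mem_insert]
        constructor
        · rintro ⟨h1, h2⟩
          by_cases hj : j = t + 1
          · exact .inl hj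
          · exact .inr ⟨by omega, h2⟩
        · rintro (rfl | ⟨h1, h2⟩)
          · exact ⟨by omega, h⟩
          · exact ⟨by omega, h2⟩
      rw [hIcc, Finset.sum_insert (by simp), Nat.add_sub_cancel]
      have e : ψ (t + 1) - applyOp (C.regGate M (t + 1)) (C.restart M bad ψ t) =
          (ψ (t + 1) - applyOp (C.regGate M (t + 1)) (ψ t)) +
            applyOp (C.regGate M (t + 1)) (ψ t - C.restart M bad ψ t) := by
        rw [applyOp_vec_sub]; abel
      rw [e]
      refine (norm_add_le _ _).trans ?_
      rw [norm_applyOp_isometry _ (C.regGate_unitary M (t + 1))]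
      gcongr

/-- An elementary replacement for the spectral gap of a path: Cauchy–Schwarz on the accumulated
defects gives one factor of the number of times, and summing over the slices gives the second. -/
theorem exists_propagating_near {v : QState (Qubits N (C.T + M))} (hv : v ∈ legal N (C.T + M))
    (bad : Finset ℕ) : ∃ u ∈ C.propagating M bad,
      ‖v - u‖ ^ 2 ≤ ((C.T + M : ℕ) + 1 : ℝ) ^ 2 * ∑ j ∈ Finset.Icc 1 (C.T + M) \ bad,
        ‖slice v j - applyOp (C.regGate M j) (slice v (j - 1))‖ ^ 2 := by
  set w := C.restart M bad (slice v) with hw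
  refine ⟨lift (C.T + M) w, ⟨lift_mem_legal w, fun t ht => ?_⟩, ?_⟩
  · rw [Finset.mem_sdiff, Finset.mem_Icc] at ht
    rw [slice_lift w (by omega), slice_lift w (by omega)]
    obtain ⟨t, rfl⟩ : ∃ s, t = s + 1 := ⟨t - 1, by omega⟩
    rw [Nat.add_sub_cancel, hw, restart, if_neg ht.2]
  · rw [norm_sq_legal (sub_mem hv (lift_mem_legal w))]
    set D := ∑ j ∈ Finset.Icc 1 (C.T + M) \ bad,
      ‖slice v j - applyOp (C.regGate M j) (slice v (j - 1))‖ ^ 2 with hD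
    have hD0 : 0 ≤ D := by positivity
    calc ∑ t ∈ Finset.range (C.T + M + 1), ‖slice (v - lift (C.T + M) w) t‖ ^ 2
        ≤ ∑ t ∈ Finset.range (C.T + M + 1), ((C.T + M : ℕ) + 1 : ℝ) * D := by
          refine Finset.sum_le_sum fun t ht => ?_
          have htK : t ≤ C.T + M := by simp at ht; omega
          rw [slice_sub, slice_lift w htK]
          have hsub : Finset.Icc 1 t \ bad ⊆ Finset.Icc 1 (C.T + M) \ bad :=
            Finset.sdiff_subset_sdiff (Finset.Icc_subset_Icc_right htK) le_rfl
          have hcard : (Finset.Icc 1 t \ bad).card ≤ C.T + M + 1 :=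
            (Finset.card_le_card Finset.sdiff_subset).trans (by simp; omega)
          calc _ ≤ (∑ j ∈ Finset.Icc 1 t \ bad,
                ‖slice v j - applyOp (C.regGate M j) (slice v (j - 1))‖) ^ 2 := by
                gcongr
                exact C.norm_sub_restart_le bad (slice v) t
            _ ≤ ((Finset.Icc 1 t \ bad).card : ℝ) * ∑ j ∈ Finset.Icc 1 t \ bad,
                ‖slice v j - applyOp (C.regGate M j) (slice v (j - 1))‖ ^ 2 :=
                sq_sum_le_card_mul_sum_sq
            _ ≤ ((C.T + M : ℕ) + 1 : ℝ) * D := by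
                gcongr
                · exact_mod_cast hcard
                · exact Finset.sum_le_sum_of_subset_of_nonneg hsub fun _ _ _ => by positivity
      _ = _ := by
          rw [Finset.sum_const, Finset.card_range, nsmul_eq_mul]
          push_cast
          ring

theorem energy_HProp1 {v : QState (Qubits N (C.T + M))} (hv : v ∈ legal N (C.T + M)) :
    energy (C.HProp1 M) v = 1 / 2 * ∑ j ∈ Finset.Icc 1 (C.T + M) \ C.czTimes M,
      ‖slice v j - applyOp (C.regGate M j) (slice v (j - 1))‖ ^ 2 := by
  rw [HProp1, energy_sum, Finset.mul_sum]
  exact Finset.sum_congr rfl fun t ht => C.energy_HPropAt hv (Finset.mem_sdiff.1 ht).1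

theorem energy_HProp1_eq_zero {v : QState (Qubits N (C.T + M))}
    (hv : v ∈ C.propagating M (C.czTimes M)) : energy (C.HProp1 M) v = 0 := by
  rw [C.energy_HProp1 hv.1, Finset.sum_eq_zero, mul_zero]
  intro t ht
  rw [hv.2 t ht]
  simp

theorem exists_near_HProp1 {v : QState (Qubits N (C.T + M))} (hv : v ∈ legal N (C.T + M)) :
    ∃ u ∈ C.propagating M (C.czTimes M),
      ‖v - u‖ ^ 2 ≤ 2 * ((C.T + M : ℕ) + 1 : ℝ) ^ 2 * energy (C.HProp1 M) v := by
  obtain ⟨u, hu, h⟩ := C.exists_propagating_near hv (C.czTimes M)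
  refine ⟨u, hu, h.trans_eq ?_⟩
  rw [C.energy_HProp1 hv]
  ring

/-- The state already obeys the single-qubit gates, so of all propagation defects only those at
controlled-Z times survive. -/
theorem exists_near_HProp2 {v : QState (Qubits N (C.T + M))}
    (hv : v ∈ C.propagating M (C.czTimes M)) :
    ∃ u ∈ C.propagating M ∅,
      ‖v - u‖ ^ 2 ≤ 2 * ((C.T + M : ℕ) + 1 : ℝ) ^ 2 * energy (C.HProp2 M) v := by
  obtain ⟨u, hu, h⟩ := C.exists_propagating_near hv.1 ∅
  refine ⟨u, hu, h.trans ?_⟩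
  have hsum : ∑ j ∈ Finset.Icc 1 (C.T + M) \ ∅,
      ‖slice v j - applyOp (C.regGate M j) (slice v (j - 1))‖ ^ 2 ≤ 2 * energy (C.HProp2 M) v := by
    refine le_trans (le_of_eq ?_) (C.energy_HProp2_ge hv)
    rw [Finset.sdiff_empty]
    symm
    refine Finset.sum_subset ?_ fun t ht ht' => ?_
    · intro t ht
      obtain ⟨_, _, _, _, _, _, _, _, _, b1, b2, _⟩ := C.czTimes_spec ht
      rw [Finset.mem_Icc]
      omega
    · rw [hv.2 t (Finset.mem_sdiff.2 ⟨ht, ht'⟩)]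
      simp
  calc _ ≤ ((C.T + M : ℕ) + 1 : ℝ) ^ 2 * (2 * energy (C.HProp2 M) v) := by gcongr
    _ = _ := by ring

/-! ### The history state -/

/-- The product of the first `t` gates of the idled circuit, on the register. -/
def regFirst (M : ℕ) : ℕ → QOp (Fin N)
  | 0 => 1
  | t + 1 => C.regGate M (t + 1) * regFirst M t

theorem firstGates_eq_tens (t : ℕ) : C.firstGates M t = tens (C.regFirst M t) 1 := by
  induction t with
  | zero => exact tens_one_one.symm
  | succ t ih => rw [firstGates, ih, idled_eq_tens, tens_mul, one_mul, regFirst]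

theorem clocked_mem_legal (z : Fin N → Bool) {t : ℕ} (ht : t ≤ C.T + M) :
    C.clocked M z t ∈ legal N (C.T + M) := by
  intro a c h
  rw [clocked, ket, PiLp.single_apply, if_neg]
  intro hc
  refine h t ht ?_
  unfold unary
  have := congrArg (fun x => x ∘ Sum.inr) hc
  simpa using this

theorem slice_clocked (z : Fin N → Bool) {s t : ℕ} (hs : s ≤ C.T + M) (ht : t ≤ C.T + M) :
    slice (C.clocked M z s) t = if s = t then ket z else 0 := by
  ext a
  rw [slice_apply, clocked, ket, PiLp.single_apply]
  change (if Sum.elim a (unary (C.T + M) t) = Sum.elim z (unary (C.T + M) s) then (1 : ℂ) else 0) = _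
  have : Sum.elim a (unary (C.T + M) t) = Sum.elim z (unary (C.T + M) s) ↔ a = z ∧ s = t := by
    constructor
    · intro h
      refine ⟨?_, unary_injOn _ hs ht ?_⟩
      · simpa using congrArg (fun x => x ∘ Sum.inl) h
      · simpa using (congrArg (fun x => x ∘ Sum.inr) h).symm
    · rintro ⟨rfl, rfl⟩; rfl
  rw [if_congr this rfl rfl]
  by_cases h : s = t
  · simp [h, ket]
  · simp [h]

/-- The normalisation of the history state. -/
def amp (M : ℕ) : ℂ := ((1 / Real.sqrt ((C.T + M + 1 : ℕ) : ℝ) : ℝ) : ℂ)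

theorem norm_amp_sq : ‖C.amp M‖ ^ 2 * ((C.T + M : ℕ) + 1 : ℝ) = 1 := by
  have h : (0 : ℝ) < ((C.T + M : ℕ) + 1 : ℝ) := by positivity
  rw [amp, Complex.norm_real, Real.norm_eq_abs, sq_abs, div_pow, one_pow,
    Real.sq_sqrt (by positivity)]
  push_cast at h ⊢
  field_simp

theorem history_mem_legal (z : Fin N → Bool) : C.history M z ∈ legal N (C.T + M) := by
  refine Submodule.smul_mem _ _ (Submodule.sum_mem _ fun t ht => ?_)
  rw [firstGates_eq_tens]
  exact tens_mem_legal (C.clocked_mem_legal z (by simp at ht; omega)) _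

theorem slice_history (z : Fin N → Bool) {t : ℕ} (ht : t ≤ C.T + M) :
    slice (C.history M z) t = C.amp M • applyOp (C.regFirst M t) (ket z) := by
  rw [history, slice_smul, slice_sum, amp]
  congr 1
  rw [Finset.sum_eq_single t]
  · rw [firstGates_eq_tens, slice_tens, C.slice_clocked z ht ht, if_pos rfl]
  · intro s hs hne
    rw [firstGates_eq_tens, slice_tens, C.slice_clocked z (by simp at hs; omega) ht, if_neg hne,
      applyOp_vec_zero]
  · intro h; simp at h; omega

theorem history_mem_propagating (z : Fin N → Bool) : C.history M z ∈ C.propagating M ∅ := by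
  refine ⟨C.history_mem_legal z, fun t ht => ?_⟩
  rw [Finset.sdiff_empty, Finset.mem_Icc] at ht
  obtain ⟨t, rfl⟩ : ∃ s, t = s + 1 := ⟨t - 1, by omega⟩
  rw [C.slice_history z ht.2, Nat.add_sub_cancel, C.slice_history z (by omega), applyOp_vec_smul,
    regFirst, applyOp_mul]

theorem norm_slice_of_propagating {v : QState (Qubits N (C.T + M))} (hv : v ∈ C.propagating M ∅)
    {t : ℕ} (ht : t ≤ C.T + M) : ‖slice v t‖ = ‖slice v 0‖ := by
  induction t with
  | zero => rfl
  | succ t ih =>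
    rw [hv.2 (t + 1) (by simp; omega), norm_applyOp_isometry _ (C.regGate_unitary M _),
      Nat.add_sub_cancel, ih (by omega)]

/-- A fully propagated state is determined by its slice at time 0, and all its slices have equal
norm. -/
theorem norm_sq_of_propagating {v : QState (Qubits N (C.T + M))} (hv : v ∈ C.propagating M ∅) :
    ‖v‖ ^ 2 = ((C.T + M : ℕ) + 1 : ℝ) * ‖slice v 0‖ ^ 2 := by
  rw [norm_sq_legal hv.1, Finset.sum_congr rfl fun t ht => by
    rw [C.norm_slice_of_propagating hv (by simp at ht; omega)], Finset.sum_const,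
    Finset.card_range, nsmul_eq_mul]
  push_cast
  ring

theorem slice_history_zero (z : Fin N → Bool) : slice (C.history M z) 0 = C.amp M • ket z := by
  rw [C.slice_history z (by omega), regFirst, applyOp_one]

theorem norm_ket {Q : Type} [Fintype Q] [DecidableEq Q] (a : Q → Bool) : ‖ket a‖ = 1 := by
  simp [ket]

theorem norm_history (z : Fin N → Bool) : ‖C.history M z‖ = 1 := by
  have h := C.norm_sq_of_propagating (C.history_mem_propagating z (M := M))
  rw [slice_history_zero, norm_smul, norm_ket, mul_one, mul_comm, norm_amp_sq] at h
  nlinarith [norm_nonneg (C.history M z)]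

/-! ### Input and output terms -/

theorem T_pos : 4 ≤ C.T := by
  have := C.five_le_L
  have h : C.L ≤ (C.T₂ + 1) * C.L := Nat.le_mul_of_pos_left _ (by omega)
  rw [T]; omega

theorem energy_HIn {v : QState (Qubits N (C.T + M))} (hv : v ∈ legal N (C.T + M))
    (z : Fin N → Bool) : energy (HIn (C.T + M) z) v =
      ∑ a, ∑ i, if a i = !(z i) then ‖slice v 0 a‖ ^ 2 else 0 := by
  rw [HIn, energy_sum, Finset.sum_comm]
  refine Finset.sum_congr rfl fun i _ => ?_
  have hT := C.T_pos
  rw [energy, ketbra, onQubit_inl, sesq_clockKB_first hv hv _ (by omega)]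
  exact energy_ketbra i (!(z i)) (slice v 0)

theorem energy_HOut {v : QState (Qubits N (C.T + M))} (hv : v ∈ legal N (C.T + M))
    (out : Fin N) : energy (HOut (C.T + M) out) v =
      ∑ a, if a out = false then ‖slice v (C.T + M) a‖ ^ 2 else 0 := by
  have hT := C.T_pos
  rw [energy, HOut, ketbra, onQubit_inl, sesq_clockKB_last hv hv _ (by omega)]
  exact energy_ketbra out false (slice v (C.T + M))

theorem energy_HOut_le {v : QState (Qubits N (C.T + M))} (hv : v ∈ legal N (C.T + M))
    (out : Fin N) : energy (HOut (C.T + M) out) v ≤ ‖slice v (C.T + M)‖ ^ 2 := by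
  rw [C.energy_HOut hv, EuclideanSpace.norm_sq_eq]
  refine Finset.sum_le_sum fun a _ => ?_
  split_ifs
  · exact le_rfl
  · positivity

theorem energy_HOut_nonneg {v : QState (Qubits N (C.T + M))} (hv : v ∈ legal N (C.T + M))
    (out : Fin N) : 0 ≤ energy (HOut (C.T + M) out) v := by
  rw [C.energy_HOut hv]
  exact Finset.sum_nonneg fun a _ => by split_ifs <;> positivity

theorem exists_near_HIn {v : QState (Qubits N (C.T + M))} (hv : v ∈ C.propagating M ∅)
    (z : Fin N → Bool) : ∃ u ∈ Submodule.span ℂ {C.history M z},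
      ‖v - u‖ ^ 2 ≤ ((C.T + M : ℕ) + 1 : ℝ) * energy (HIn (C.T + M) z) v := by
  have hamp : C.amp M ≠ 0 := by
    intro h
    have := C.norm_amp_sq (M := M)
    simp [h] at this
  -- This multiple agrees with `v` at `z` at time 0. What is left there lives on strings with a
  -- wrong bit, each penalized at least once.
  refine ⟨(slice v 0 z / C.amp M) • C.history M z,
    Submodule.smul_mem _ _ (Submodule.mem_span_singleton_self _), ?_⟩
  rw [C.norm_sq_of_propagating (sub_mem hv (Submodule.smul_mem _ _ (C.history_mem_propagating z))),
    slice_sub, slice_smul, slice_history_zero, smul_smul, div_mul_cancel₀ _ hamp,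
    EuclideanSpace.norm_sq_eq, C.energy_HIn hv.1]
  gcongr with a
  rw [PiLp.sub_apply, PiLp.smul_apply, ket, PiLp.single_apply]
  by_cases h : a = z
  · subst h
    simp
  · rw [if_neg h, smul_zero, sub_zero]
    obtain ⟨i, hi⟩ := Function.ne_iff.1 h
    refine le_trans ?_ (Finset.single_le_sum (fun j _ => ?_) (Finset.mem_univ i))
    · rw [if_pos (by cases h1 : a i <;> cases h2 : z i <;> simp_all)]
    · split_ifs <;> positivity

theorem energy_HIn_history (z : Fin N → Bool) : energy (HIn (C.T + M) z) (C.history M z) = 0 := by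
  rw [C.energy_HIn (C.history_mem_legal z)]
  refine Finset.sum_eq_zero fun a _ => Finset.sum_eq_zero fun i _ => ?_
  split_ifs with h
  · rw [slice_history_zero, PiLp.smul_apply, ket, PiLp.single_apply, if_neg]
    · simp
    · rintro rfl
      simp at h
  · rfl

end RegularCircuit

/-! ### Ground states -/

section GroundState

variable {Q : Type} [Fintype Q] [DecidableEq Q]

theorem IsLocalHamiltonian.isHermitian {k : ℕ} {H : QOp Q} (h : IsLocalHamiltonian k H) :
    H.IsHermitian := by
  obtain ⟨m, h, h1, rfl⟩ := h
  rw [Matrix.IsHermitian, Matrix.conjTranspose_sum]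
  exact Finset.sum_congr rfl fun i _ => (h1 i).1

/-- Variational principle: in finite dimension the infimum of the Rayleigh quotient is an
eigenvalue, hence at least the ground energy. -/
theorem energy_groundState_le {H : QOp Q} (hH : H.IsHermitian) {φ : QState Q}
    (hφ : IsGroundState H φ) {ψ : QState Q} (hψ : ‖ψ‖ = 1) : energy H φ ≤ energy H ψ := by
  obtain ⟨hφ1, E, hE, hmin⟩ := hφ
  have hsymm : (Matrix.toEuclideanLin H).IsSymmetric :=
    Matrix.isSymmetric_toEuclideanLin_iff.2 hH
  have hφE : energy H φ = E := by
    rw [energy, sesq, hE, inner_smul_right, inner_self_eq_norm_sq_to_K, hφ1]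
    simp
  have hψ0 : ψ ≠ 0 := by
    rintro rfl
    simp at hψ
  have : Nontrivial (QState Q) := ⟨ψ, 0, hψ0⟩
  have hev := hsymm.hasEigenvalue_iInf_of_finiteDimensional
  have h1 := hmin _ hev
  rw [hφE]
  refine h1.trans ?_
  have hb : BddBelow (Set.range fun x : { x : QState Q // x ≠ 0 } =>
      RCLike.re (inner ℂ (Matrix.toEuclideanLin H x) (x : QState Q)) / ‖(x : QState Q)‖ ^ 2) := by
    refine ⟨-opNorm H, ?_⟩
    rintro _ ⟨x, rfl⟩
    have hx : 0 < ‖(x : QState Q)‖ := norm_pos_iff.2 x.2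
    have h2 := (abs_le.1 (abs_sesq_re_le H x x)).1
    change _ ≤ _ / _
    rw [le_div_iff₀ (by positivity), hsymm]
    change _ ≤ (sesq H x x).re
    linarith
  refine (ciInf_le hb ⟨ψ, hψ0⟩).trans_eq ?_
  change RCLike.re (inner ℂ (Matrix.toEuclideanLin H ψ) ψ) / ‖ψ‖ ^ 2 = _
  rw [hsymm, hψ]
  simp [energy, sesq, applyOp]

end GroundState

/-- The polynomial used in all four conditions on the coefficients. -/
def couplingPoly : Polynomial ℕ := 1000 * (Polynomial.X + 1) ^ 4

theorem eval_couplingPoly (x : ℝ) :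
    (couplingPoly.map (Nat.castRingHom ℝ)).eval x = 1000 * (x + 1) ^ 4 := by
  simp [couplingPoly]

/-- With `a ≤ 2 * x` the bracket is at most `38 * (x + 1) ^ 2 * Δ`, so 76 would do in place of 1000.
-/
theorem coupling_bound {x c a Δ J : ℝ} (hx : 0 ≤ x) (hΔ : 1 ≤ Δ)
    (hc : c ≤ 2 * (x + 1) ^ 2) (ha0 : 0 ≤ a) (ha : a ≤ 2 * x) (hJ : 1000 * (x + 1) ^ 4 * Δ ≤ J) :
    c * (9 * a ^ 2 + 2 * Δ) ≤ J := by
  refine le_trans ?_ hJ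
  have h1 : 9 * a ^ 2 + 2 * Δ ≤ 38 * (x + 1) ^ 2 * Δ := by
    have : a ^ 2 ≤ 4 * (x + 1) ^ 2 := by nlinarith
    nlinarith [sq_nonneg (x + 1), mul_nonneg hx hx]
  calc c * (9 * a ^ 2 + 2 * Δ) ≤ 2 * (x + 1) ^ 2 * (38 * (x + 1) ^ 2 * Δ) := by gcongr
    _ = 76 * ((x + 1) ^ 4 * Δ) := by ring
    _ ≤ 1000 * ((x + 1) ^ 4 * Δ) := by gcongr; norm_num
    _ = _ := by ring

theorem coupling_mono {x s Δ J : ℝ} (hx : 0 ≤ x) (hs : 1 ≤ s) (hΔ : 1 ≤ Δ)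
    (h : 1000 * (x * s + 1) ^ 4 * Δ ≤ J) : 1000 * (x + 1) ^ 4 * Δ ≤ J := by
  refine le_trans ?_ h
  have : x ≤ x * s := le_mul_of_one_le_right hx hs
  gcongr

theorem le_coupling {x Δ : ℝ} (hx : 0 ≤ x) (hΔ : 1 ≤ Δ) : x ≤ 1000 * (x + 1) ^ 4 * Δ := by
  have : 1 ≤ (x + 1) ^ 3 := one_le_pow₀ (by linarith)
  calc x ≤ 1000 * (x + 1) * 1 * 1 := by linarith
    _ ≤ 1000 * (x + 1) * (x + 1) ^ 3 * Δ := by gcongr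
    _ = _ := by ring

/-- Four successive applications of the projection lemma, down to the line spanned by `η`. -/
theorem projection_chain {Q : Type} [Fintype Q] [DecidableEq Q] {S₁ S₂ S₃ : Submodule ℂ (QState Q)}
    {η φ : QState Q} (hη₁ : η ∈ S₁) (hη₂ : η ∈ S₂) (hη₃ : η ∈ S₃) (hη : ‖η‖ = 1) (hφ : ‖φ‖ = 1)
    {O Hin H2 H1 Hc : QOp Q} {Jin J2 J1 Jc Δ a₀ a₁ a₂ a₃ c₀ c₁ c₂ c₃ : ℝ} (hΔ : 0 < Δ)
    (ha₀ : opNorm (O + Jin • Hin + J2 • H2 + J1 • H1) ≤ a₀)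
    (ha₁ : opNorm (O + Jin • Hin + J2 • H2) ≤ a₁)
    (ha₂ : opNorm (O + Jin • Hin) ≤ a₂) (ha₃ : opNorm O ≤ a₃)
    (hc₀ : 0 < c₀) (hc₁ : 0 < c₁) (hc₂ : 0 < c₂) (hc₃ : 0 < c₃)
    (hJ₀ : c₀ * (9 * a₀ ^ 2 + 2 * Δ) ≤ Jc) (hJ₁ : c₁ * (9 * a₁ ^ 2 + 2 * Δ) ≤ J1)
    (hJ₂ : c₂ * (9 * a₂ ^ 2 + 2 * Δ) ≤ J2) (hJ₃ : c₃ * (9 * a₃ ^ 2 + 2 * Δ) ≤ Jin)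
    (hn₀ : ∀ v, ∃ u ∈ S₁, ‖v - u‖ ^ 2 ≤ c₀ * energy Hc v)
    (hn₁ : ∀ v ∈ S₁, ∃ u ∈ S₂, ‖v - u‖ ^ 2 ≤ c₁ * energy H1 v)
    (hn₂ : ∀ v ∈ S₂, ∃ u ∈ S₃, ‖v - u‖ ^ 2 ≤ c₂ * energy H2 v)
    (hn₃ : ∀ v ∈ S₃, ∃ u ∈ Submodule.span ℂ {η}, ‖v - u‖ ^ 2 ≤ c₃ * energy Hin v)
    (hO : ∀ v ∈ Submodule.span ℂ {η}, 0 ≤ energy O v)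
    (hE : energy (O + Jin • Hin + J2 • H2 + J1 • H1 + Jc • Hc) φ ≤ 1) :
    1 - 1 / Δ ≤ fidelity φ η := by
  obtain ⟨w1, hw1, hn1, hp1, ho1, he1⟩ :=
    projection_step S₁ _ Hc φ hφ.le ha₀ hΔ.le hc₀ hJ₀ (hn₀ φ)
  obtain ⟨w2, hw2, hn2, hp2, ho2, he2⟩ :=
    projection_step S₂ _ H1 w1 hn1 ha₁ hΔ.le hc₁ hJ₁ (hn₁ w1 hw1)
  obtain ⟨w3, hw3, hn3, hp3, ho3, he3⟩ :=
    projection_step S₃ _ H2 w2 hn2 ha₂ hΔ.le hc₂ hJ₂ (hn₂ w2 hw2)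
  obtain ⟨w4, hw4, -, hp4, ho4, he4⟩ :=
    projection_step _ _ Hin w3 hn3 ha₃ hΔ.le hc₃ hJ₃ (hn₃ w3 hw3)
  have h5 := hO w4 hw4
  -- The right side is the energy bound 1 plus four losses of 1/4.
  have hsum : 2 * Δ * (‖φ - w1‖ ^ 2 + ‖w1 - w2‖ ^ 2 + ‖w2 - w3‖ ^ 2 + ‖w3 - w4‖ ^ 2) ≤ 2 := by
    linarith
  -- `η` lies in every subspace of the chain, so it is orthogonal to all displacements.
  have hinner : inner ℂ η φ = inner ℂ η w4 := by
    have e1 := ho1 _ hη₁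
    have e2 := ho2 _ hη₂
    have e3 := ho3 _ hη₃
    have e4 := ho4 _ (Submodule.mem_span_singleton_self η)
    rw [inner_sub_right, sub_eq_zero] at e1 e2 e3 e4
    rw [e1, e2, e3, e4]
  have hfid : fidelity φ η = ‖w4‖ ^ 2 := by
    obtain ⟨c, rfl⟩ := Submodule.mem_span_singleton.1 hw4
    rw [fidelity, norm_inner_symm, hinner, inner_smul_right, inner_self_eq_norm_sq_to_K, hη,
      norm_smul, hη]
    simp
  rw [hfid]
  have hd : ‖φ - w1‖ ^ 2 + ‖w1 - w2‖ ^ 2 + ‖w2 - w3‖ ^ 2 + ‖w3 - w4‖ ^ 2 ≤ 1 / Δ := by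
    rw [le_div_iff₀ hΔ]
    linarith
  rw [hφ] at hp1
  linarith

/-! ### Test states, lower bounds on norms, and the fidelity with the history state. -/

namespace RegularCircuit

variable {N : ℕ} (C : RegularCircuit N) {M : ℕ}

theorem energy_HProp1_nonneg {v : QState (Qubits N (C.T + M))} (hv : v ∈ legal N (C.T + M)) :
    0 ≤ energy (C.HProp1 M) v := by
  rw [C.energy_HProp1 hv]
  positivity

/-- A controlled-Z term at time `t` sees only the slices from `t - 3` to `t + 2`, and `t ≥ M + 5`,
so time 0 is out of reach. -/
theorem energy_HProp2_eq_zero_of_slice {v : QState (Qubits N (C.T + M))}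
    (hv : v ∈ legal N (C.T + M)) (h : ∀ t, 1 ≤ t → t ≤ C.T + M → slice v t = 0) :
    energy (C.HProp2 M) v = 0 := by
  rw [HProp2, energy_sum]
  refine Finset.sum_eq_zero fun t ht => ?_
  obtain ⟨f, s, hfs, hg, _, _, _, _, _, b1, b2, _⟩ := C.czTimes_spec ht
  rw [energy, sesq_add, C.sesq_HQubitAt hv (by omega) (by omega) hg,
    C.sesq_HTimeAt hv (by omega) (by omega), h t (by omega) (by omega),
    h (t - 1) (by omega) (by omega), h (t + 1) (by omega) (by omega),
    h (t + 2) (by omega) (by omega), h (t - 3) (by omega) (by omega),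
    h (t - 2) (by omega) (by omega)]
  simp [sesq]

theorem norm_clocked (z : Fin N → Bool) (t : ℕ) : ‖C.clocked M z t‖ = 1 := norm_ket _

theorem le_opNorm_of_HIn (hN : 0 < N) (z : Fin N → Bool) (out : Fin N) {Jin J2 J1 : ℝ}
    (hin : 0 ≤ Jin) (h1 : 0 ≤ J1) :
    Jin ≤ opNorm (HOut (C.T + M) out + Jin • HIn (C.T + M) z + J2 • C.HProp2 M +
      J1 • C.HProp1 M) := by
  -- Every input bit is wrong and the clock is at 0: the input term contributes at least `Jin`, and
  -- no other term is negative.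
  set v := C.clocked M (fun i => !(z i)) 0 with hv
  have hl : v ∈ legal N (C.T + M) := C.clocked_mem_legal _ (by omega)
  have hs : ∀ t, 1 ≤ t → t ≤ C.T + M → slice v t = 0 := fun t h h' => by
    rw [hv, C.slice_clocked _ (by omega) h', if_neg (by omega)]
  refine le_trans ?_ (energy_le_opNorm _ v (C.norm_clocked _ _))
  rw [energy_add, energy_add, energy_add, energy_smul, energy_smul, energy_smul,
    C.energy_HProp2_eq_zero_of_slice hl hs]
  have e1 := C.energy_HOut_nonneg hl out
  have e2 := C.energy_HProp1_nonneg hl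
  have e3 : 1 ≤ energy (HIn (C.T + M) z) v := by
    rw [C.energy_HIn hl, hv, C.slice_clocked _ (by omega) (by omega), if_pos rfl]
    refine le_trans ?_ (Finset.single_le_sum (fun a _ => Finset.sum_nonneg fun i _ => ?_)
      (Finset.mem_univ fun i => !(z i)))
    · refine le_trans ?_ (Finset.single_le_sum (fun i _ => ?_) (Finset.mem_univ (⟨0, hN⟩ : Fin N)))
      · simp [ket]
      · split_ifs <;> positivity
    · split_ifs <;> positivity
  nlinarith [mul_nonneg h1 e2]

theorem one_le_opNorm_HOut (out : Fin N) : 1 ≤ opNorm (HOut (C.T + M) out) := by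
  set v := C.clocked M (fun _ => false) (C.T + M) with hv
  have hl : v ∈ legal N (C.T + M) := C.clocked_mem_legal _ (by omega)
  refine le_trans ?_ (energy_le_opNorm _ v (C.norm_clocked _ _))
  rw [C.energy_HOut hl, hv, C.slice_clocked _ (by omega) (by omega), if_pos rfl]
  refine le_trans ?_ (Finset.single_le_sum (fun a _ => ?_) (Finset.mem_univ fun _ => false))
  · simp [ket]
  · split_ifs <;> positivity

/-- Only the output term is nonzero. The final slice has squared norm 1/(T+M+1), which beats the
coefficient T+M. -/
theorem energy_history_le (z : Fin N → Bool) (out : Fin N) (J : Couplings) :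
    energy (C.hamiltonian M z out J) (C.history M z) ≤ 1 := by
  have hp := C.history_mem_propagating z (M := M)
  rw [hamiltonian]
  simp only [energy_add, energy_smul]
  rw [C.energy_HIn_history, energy_HClock_legal hp.1,
    C.energy_HProp1_eq_zero (C.propagating_mono (by simp) hp), C.energy_HProp2_eq_zero hp]
  have h1 := C.energy_HOut_le hp.1 out
  have h2 := C.norm_sq_of_propagating hp
  rw [C.norm_slice_of_propagating hp le_rfl] at h1
  rw [C.norm_history] at h2
  have h3 : ((C.T + M : ℕ) : ℝ) * energy (HOut (C.T + M) out) (C.history M z) ≤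
      ((C.T + M : ℕ) : ℝ) * ‖slice (C.history M z) 0‖ ^ 2 := by gcongr
  nlinarith [sq_nonneg ‖slice (C.history M z) 0‖]

/-- Passes from coefficient 1 of the output term, as in the coupling conditions, to its coefficient
in the Hamiltonian. -/
theorem opNorm_add_HOut_le (A : QOp (Qubits N (C.T + M))) (out : Fin N) (hT : 1 ≤ C.T + M) :
    opNorm (A + ((C.T + M : ℕ) : ℝ) • HOut (C.T + M) out) ≤
      opNorm (HOut (C.T + M) out + A) + opNorm (HOut (C.T + M) out) * ((C.T + M : ℕ) : ℝ) := by
  have e : A + ((C.T + M : ℕ) : ℝ) • HOut (C.T + M) out =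
      (HOut (C.T + M) out + A) + (((C.T + M : ℕ) : ℝ) - 1) • HOut (C.T + M) out := by
    rw [sub_smul, one_smul]; abel
  rw [e]
  refine (opNorm_add_le _ _).trans ?_
  have h1 : (1 : ℝ) ≤ ((C.T + M : ℕ) : ℝ) := by exact_mod_cast hT
  rw [opNorm_real_smul, abs_of_nonneg (by linarith)]
  nlinarith [opNorm_nonneg (HOut (C.T + M) out)]

theorem fidelity_history (hN : 0 < N) (z : Fin N → Bool) (out : Fin N) (J : Couplings) {Δ : ℝ}
    (hM : C.L < M) (hΔ : 1 ≤ Δ)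
    (hJ : C.CouplingConditions M (couplingPoly.map (Nat.castRingHom ℝ))
      (couplingPoly.map (Nat.castRingHom ℝ)) (couplingPoly.map (Nat.castRingHom ℝ))
      (couplingPoly.map (Nat.castRingHom ℝ)) z out J Δ)
    {φ : QState (Qubits N (C.T + M))} (hφ : IsGroundState (C.hamiltonian M z out J) φ) :
    1 - 1 / Δ ≤ fidelity φ (C.history M z) := by
  obtain ⟨h0, h1, h2, h3⟩ := hJ
  simp only [eval_couplingPoly] at h0 h1 h2 h3
  have hT4 := C.T_pos
  have hT1 : (1 : ℝ) ≤ (C.T : ℝ) := by exact_mod_cast (by omega : 1 ≤ C.T)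
  have hM1 : (1 : ℝ) ≤ (M : ℝ) := by exact_mod_cast (by omega : 1 ≤ M)
  have hK0 : (0 : ℝ) ≤ ((C.T + M : ℕ) : ℝ) := by positivity
  have hloc := C.isLocalHamiltonian_hamiltonian M hN z out J
  have hout := C.one_le_opNorm_HOut (M := M) out
  have ho := fun A => C.opNorm_add_HOut_le (M := M) A out (by omega)
  have n0 := C.le_opNorm_of_HIn (M := M) hN z out (Jin := J.Jin) (J2 := J.J2) (J1 := J.J1)
  have n1 := C.le_opNorm_of_HIn (M := M) hN z out (Jin := J.Jin) (J2 := J.J2) (J1 := 0)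
  have n2 := C.le_opNorm_of_HIn (M := M) hN z out (Jin := J.Jin) (J2 := 0) (J1 := 0)
  simp only [zero_smul, add_zero, le_refl, true_implies] at n1 n2
  have b2 := ho (J.Jin • HIn (C.T + M) z)
  have b1 := ho (J.Jin • HIn (C.T + M) z + J.J2 • C.HProp2 M)
  have b0 := ho (J.Jin • HIn (C.T + M) z + J.J2 • C.HProp2 M + J.J1 • C.HProp1 M)
  simp only [← add_assoc] at b1 b0
  have hE := (energy_groundState_le hloc.isHermitian hφ (C.norm_history z)).trans
    (C.energy_history_le z out J)
  have hH : C.hamiltonian M z out J = ((C.T + M : ℕ) : ℝ) • HOut (C.T + M) out +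
      J.Jin • HIn (C.T + M) z + J.J2 • C.HProp2 M +
      J.J1 • C.HProp1 M + J.Jclock • HClock N (C.T + M) := by
    rw [hamiltonian]; abel
  rw [hH] at hE
  have r2 : J.Jin • HIn (C.T + M) z + ((C.T + M : ℕ) : ℝ) • HOut (C.T + M) out =
    ((C.T + M : ℕ) : ℝ) • HOut (C.T + M) out + J.Jin • HIn (C.T + M) z := add_comm _ _
  have r1 : J.Jin • HIn (C.T + M) z + J.J2 • C.HProp2 M +
      ((C.T + M : ℕ) : ℝ) • HOut (C.T + M) out =
    ((C.T + M : ℕ) : ℝ) • HOut (C.T + M) out + J.Jin • HIn (C.T + M) z + J.J2 • C.HProp2 M := by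
    abel
  have r0 : J.Jin • HIn (C.T + M) z + J.J2 • C.HProp2 M + J.J1 • C.HProp1 M +
      ((C.T + M : ℕ) : ℝ) • HOut (C.T + M) out =
    ((C.T + M : ℕ) : ℝ) • HOut (C.T + M) out + J.Jin • HIn (C.T + M) z + J.J2 • C.HProp2 M +
      J.J1 • C.HProp1 M := by
    abel
  rw [r0] at b0
  rw [r1] at b1
  rw [r2] at b2
  have b3 : opNorm (((C.T + M : ℕ) : ℝ) • HOut (C.T + M) out) =
      opNorm (HOut (C.T + M) out) * ((C.T + M : ℕ) : ℝ) := by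
    rw [opNorm_real_smul, abs_of_nonneg hK0, mul_comm]
  have hKy : ((C.T + M : ℕ) : ℝ) ≤ opNorm (HOut (C.T + M) out) * ((C.T + M : ℕ) : ℝ) :=
    le_mul_of_one_le_left hK0 hout
  have hhist := C.history_mem_propagating z (M := M)
  have hO : ∀ v ∈ Submodule.span ℂ {C.history M z},
      0 ≤ energy (((C.T + M : ℕ) : ℝ) • HOut (C.T + M) out) v := by
    intro v hv
    rw [energy_smul]
    exact mul_nonneg hK0 (C.energy_HOut_nonneg
      ((Submodule.span_singleton_le_iff_mem _ _).2 hhist.1 hv) out)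
  have hn1 := fun v hv => C.exists_near_HProp1 (M := M) (v := v) hv
  have hn2 := fun v hv => C.exists_near_HProp2 (M := M) (v := v) hv
  have hn3 := fun v hv => C.exists_near_HIn (M := M) (v := v) hv z
  generalize opNorm (HOut (C.T + M) out + J.Jin • HIn (C.T + M) z + J.J2 • C.HProp2 M +
    J.J1 • C.HProp1 M) = x0 at *
  generalize opNorm (HOut (C.T + M) out + J.Jin • HIn (C.T + M) z + J.J2 • C.HProp2 M) = x1 at *
  generalize opNorm (HOut (C.T + M) out + J.Jin • HIn (C.T + M) z) = x2 at *
  generalize opNorm (HOut (C.T + M) out) * ((C.T + M : ℕ) : ℝ) = y at *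
  generalize ((C.T + M : ℕ) : ℝ) = K at *
  -- With `K ≤ y ≤ J.Jin ≤ xᵢ`, each norm controls both the chain length in the constants `cᵢ` and
  -- the extra output term, so `2 * xᵢ` bounds the true norms.
  have hyJ : y ≤ J.Jin := (le_coupling (hK0.trans hKy) hΔ).trans h3
  have hJin : 0 ≤ J.Jin := by linarith
  have hJ1 : 0 ≤ J.J1 := le_trans (by positivity) h1
  have g0 : J.Jin ≤ x0 := n0 hJin hJ1
  have g1 : J.Jin ≤ x1 := n1 hJin
  have g2 : J.Jin ≤ x2 := n2 hJin
  -- The factors `M` and `C.T` in the arguments of the polynomials are at least 1 and are dropped.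
  replace h1 := coupling_mono (by linarith) hM1 hΔ h1
  replace h2 := coupling_mono (by linarith) hT1 hΔ h2
  have hc : ∀ x, y ≤ x → 2 * (K + 1) ^ 2 ≤ 2 * (x + 1) ^ 2 := by
    intro x hx
    have : K + 1 ≤ x + 1 := by linarith
    gcongr
  refine projection_chain hhist.1 (C.propagating_mono (Finset.empty_subset _) hhist) hhist
    (C.norm_history z) hφ.1 (by linarith) (a₀ := 2 * x0) (a₁ := 2 * x1) (a₂ := 2 * x2) (a₃ := y)
    (by linarith) (by linarith) (by linarith) b3.le
    one_pos (by positivity) (by positivity) (by positivity) ?_ ?_ ?_ ?_ exists_legal_near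
    hn1 hn2 hn3 hO hE
  · exact coupling_bound (by linarith) hΔ (by nlinarith) (by linarith) le_rfl h0
  · exact coupling_bound (by linarith) hΔ (hc _ (by linarith)) (by linarith)
      le_rfl h1
  · exact coupling_bound (by linarith) hΔ (hc _ (by linarith)) (by linarith)
      le_rfl h2
  · exact coupling_bound (by linarith) hΔ (by nlinarith) (by linarith)
      (by linarith) h3

end RegularCircuit

/-! ### Fidelities -/

section Fidelity

variable {Q : Type} [Fintype Q] [DecidableEq Q]

theorem norm_sub_inner_smul_sq {φ : QState Q} (hφ : ‖φ‖ = 1) (x : QState Q) :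
    ‖x - inner ℂ φ x • φ‖ ^ 2 = ‖x‖ ^ 2 - ‖inner ℂ φ x‖ ^ 2 := by
  have h0 : inner ℂ (x - inner ℂ φ x • φ) (inner ℂ φ x • φ) = 0 := by
    rw [inner_smul_right, inner_sub_left, inner_smul_left, inner_self_eq_norm_sq_to_K, hφ,
      inner_conj_symm]
    simp
  have h := norm_add_sq_eq_norm_sq_add_norm_sq_of_inner_eq_zero (𝕜 := ℂ) _ _ h0
  rw [sub_add_cancel, norm_smul, hφ, mul_one] at h
  nlinarith

/-- The square root of the infidelity is the distance from a unit vector to a complex line, and such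
distances satisfy a triangle inequality. -/
theorem fidelity_triangle {φ η u : QState Q} (hφ : ‖φ‖ = 1) (hη : ‖η‖ = 1) (hu : ‖u‖ = 1)
    {δ ε : ℝ} (h1 : 1 - δ ≤ fidelity φ η) (h2 : 1 - ε ≤ fidelity η u) :
    1 - (Real.sqrt ε + Real.sqrt δ) ^ 2 ≤ fidelity φ u := by
  have k1 := norm_sub_inner_smul_sq hφ η
  have k2 := norm_sub_inner_smul_sq hη u
  have k3 := norm_sub_inner_smul_sq hφ u
  have k4 := norm_sub_inner_smul_sq hφ (u - inner ℂ η u • η)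
  rw [hη] at k1
  rw [hu] at k2 k3
  unfold fidelity at *
  have a1 : ‖η - inner ℂ φ η • φ‖ ≤ Real.sqrt δ := Real.le_sqrt_of_sq_le (by linarith)
  have a2 : ‖u - inner ℂ η u • η‖ ≤ Real.sqrt ε := Real.le_sqrt_of_sq_le (by linarith)
  have a3 : ‖(u - inner ℂ η u • η) - inner ℂ φ (u - inner ℂ η u • η) • φ‖ ≤ Real.sqrt ε :=
    le_trans (le_of_sq_le_sq (by nlinarith [sq_nonneg ‖inner ℂ φ (u - inner ℂ η u • η)‖])
      (norm_nonneg _)) a2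
  have a4 : ‖inner ℂ η u‖ ≤ 1 := by
    have := norm_inner_le_norm (𝕜 := ℂ) η u
    rwa [hη, hu, mul_one] at this
  -- Split `u` along `η`; projecting away `φ` does not lengthen the part orthogonal to `η`.
  have e : u - inner ℂ φ u • φ = ((u - inner ℂ η u • η) -
      inner ℂ φ (u - inner ℂ η u • η) • φ) + inner ℂ η u • (η - inner ℂ φ η • φ) := by
    rw [inner_sub_right, inner_smul_right]
    module
  have a5 : ‖u - inner ℂ φ u • φ‖ ≤ Real.sqrt ε + Real.sqrt δ := by
    rw [e]
    refine (norm_add_le _ _).trans (add_le_add a3 ?_)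
    rw [norm_smul]
    calc _ ≤ 1 * Real.sqrt δ := by gcongr
      _ = _ := one_mul _
  have a6 : ‖u - inner ℂ φ u • φ‖ ^ 2 ≤ (Real.sqrt ε + Real.sqrt δ) ^ 2 := by gcongr
  linarith

theorem IsSemiClassical.mono {s t : ℕ} (h : s ≤ t)
    {ψ : QState Q} (hψ : IsSemiClassical s ψ) : IsSemiClassical t ψ := by
  obtain ⟨S, h1, h2, h3⟩ := hψ
  exact ⟨S, h1, h2.trans h, h3⟩

end Fidelity

namespace RegularCircuit

variable {N : ℕ} (C : RegularCircuit N) {M : ℕ}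

/-! ### The guiding state -/

theorem isSemiClassical_guiding (z : Fin N → Bool) :
    IsSemiClassical (M + 1) (C.guiding M z) := by
  have hinj : Set.InjOn (fun t => (Sum.elim z (unary (C.T + M) t) : Qubits N (C.T + M) → Bool))
      (Finset.range (M + 1) : Set ℕ) := by
    intro s hs t ht h
    simp only [Finset.coe_range, Set.mem_Iio] at hs ht
    refine unary_injOn (C.T + M) (by omega) (by omega) ?_
    simpa using congrArg (fun x => x ∘ Sum.inr) h
  have hcard := Finset.card_image_of_injOn hinj
  rw [Finset.card_range] at hcard
  refine ⟨_, ?_, hcard.le, ?_⟩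
  · rw [← Finset.card_pos, hcard]; omega
  · rw [hcard, Finset.sum_image hinj]
    rfl

theorem inner_clocked {v : QState (Qubits N (C.T + M))} (hv : v ∈ legal N (C.T + M))
    (z : Fin N → Bool) {t : ℕ} (ht : t ≤ C.T + M) :
    inner ℂ v (C.clocked M z t) = inner ℂ (slice v t) (ket z) := by
  rw [inner_legal hv, Finset.sum_eq_single t]
  · rw [C.slice_clocked z ht ht, if_pos rfl]
  · intro s hs hne
    rw [C.slice_clocked z ht (by simp at hs; omega), if_neg hne.symm, inner_zero_right]
  · intro h; simp at h; omega

theorem guiding_mem_legal (z : Fin N → Bool) : C.guiding M z ∈ legal N (C.T + M) :=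
  Submodule.smul_mem _ _ (Submodule.sum_mem _ fun t ht =>
    C.clocked_mem_legal z (by simp at ht; omega))

/-- The overlap with the guiding state of a legal state that is constant up to time `M`. -/
theorem norm_inner_guiding_sq {v : QState (Qubits N (C.T + M))} (hv : v ∈ legal N (C.T + M))
    (z : Fin N → Bool) {α : ℂ} (h : ∀ t ≤ M, slice v t = α • ket z) :
    ‖inner ℂ v (C.guiding M z)‖ ^ 2 = (M + 1) * ‖α‖ ^ 2 := by
  have h1 : inner ℂ v (C.guiding M z) =
      ((1 / Real.sqrt ((M + 1 : ℕ) : ℝ) : ℝ) : ℂ) * ((M + 1 : ℕ) * star α) := by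
    rw [guiding, inner_smul_right, inner_sum, Finset.sum_congr rfl fun t ht => by
      rw [C.inner_clocked hv z (by simp at ht; omega), h t (by simp at ht; omega),
        inner_smul_left, inner_self_eq_norm_sq_to_K, norm_ket], Finset.sum_const,
      Finset.card_range, nsmul_eq_mul]
    simp
  have h2 : (0 : ℝ) < M + 1 := by positivity
  rw [h1, norm_mul, norm_mul, norm_star, Complex.norm_natCast, Complex.norm_real,
    Real.norm_eq_abs, mul_pow, mul_pow, sq_abs, div_pow, Real.sq_sqrt (by positivity)]
  push_cast
  field_simp

theorem slice_guiding (z : Fin N → Bool) {t : ℕ} (ht : t ≤ M) :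
    slice (C.guiding M z) t = ((1 / Real.sqrt ((M + 1 : ℕ) : ℝ) : ℝ) : ℂ) • ket z := by
  rw [guiding, slice_smul, slice_sum, Finset.sum_eq_single t]
  · rw [C.slice_clocked z (by omega) (by omega), if_pos rfl]
  · intro s hs hne
    rw [C.slice_clocked z (by simp at hs; omega) (by omega), if_neg hne]
  · intro h; simp at h; omega

theorem norm_guiding (z : Fin N → Bool) : ‖C.guiding M z‖ = 1 := by
  have h := C.norm_inner_guiding_sq (C.guiding_mem_legal (M := M) z) z fun t ht => C.slice_guiding z ht
  have h2 : (0 : ℝ) < M + 1 := by positivity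
  rw [inner_self_eq_norm_sq_to_K, Complex.norm_real, Real.norm_eq_abs, sq_abs, div_pow,
    Real.sq_sqrt (by positivity)] at h
  push_cast at h
  rw [one_pow, mul_one_div_cancel h2.ne'] at h
  simp only [norm_pow, Complex.coe_algebraMap, Complex.norm_real, norm_norm] at h
  have h3 := norm_nonneg (C.guiding M z)
  rw [← pow_mul] at h
  exact (pow_eq_one_iff_of_nonneg h3 (by norm_num)).1 h

theorem regFirst_of_le {t : ℕ} (ht : t ≤ M) : C.regFirst M t = 1 := by
  induction t with
  | zero => rfl
  | succ t ih => rw [regFirst, ih (by omega), regGate, if_pos ht, mul_one]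

/-- The first `M + 1` slices of the history state are equal multiples of `ket z`, so the fidelity is
(M+1)/(T+M+1). -/
theorem fidelity_history_guiding (hM : 0 < M) (z : Fin N → Bool) :
    1 - (C.T : ℝ) / M ≤ fidelity (C.history M z) (C.guiding M z) := by
  rw [fidelity, C.norm_inner_guiding_sq (C.history_mem_legal z) z (α := C.amp M) fun t ht => by
    rw [C.slice_history z (by omega), C.regFirst_of_le ht, applyOp_one]]
  have h1 := C.norm_amp_sq (M := M)
  have hM' : (0 : ℝ) < M := by exact_mod_cast hM
  have hT : (0 : ℝ) ≤ C.T := by positivity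
  push_cast at h1
  have h2 : ‖C.amp M‖ ^ 2 = 1 / (C.T + M + 1) := by
    rw [eq_div_iff (by positivity), h1]
  rw [h2, mul_one_div, sub_le_iff_le_add, div_add_div _ _ (by positivity) (by positivity),
    le_div_iff₀ (by positivity)]
  nlinarith

theorem fidelity_bounds (hN : 0 < N) (z : Fin N → Bool) (out : Fin N) (J : Couplings) {Δ : ℝ}
    (hM : C.L < M) (hΔ : 0 < Δ)
    (hJ : C.CouplingConditions M (couplingPoly.map (Nat.castRingHom ℝ))
      (couplingPoly.map (Nat.castRingHom ℝ)) (couplingPoly.map (Nat.castRingHom ℝ))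
      (couplingPoly.map (Nat.castRingHom ℝ)) z out J Δ)
    {φ : QState (Qubits N (C.T + M))} (hφ : IsGroundState (C.hamiltonian M z out J) φ) :
    1 - 1 / Δ ≤ fidelity φ (C.history M z) ∧
      1 - (Real.sqrt ((C.T : ℝ) / M) + Real.sqrt (1 / Δ)) ^ 2 ≤ fidelity φ (C.guiding M z) := by
  have h1 : 1 - 1 / Δ ≤ fidelity φ (C.history M z) := by
    -- For `Δ < 1` the claimed lower bound is negative, so only `1 ≤ Δ` needs the coupling
    -- conditions.
    rcases le_or_gt 1 Δ with h | h
    · exact C.fidelity_history hN z out J hM h hJ hφ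
    · have : 1 ≤ 1 / Δ := (one_le_div hΔ).2 h.le
      have h2 : 0 ≤ fidelity φ (C.history M z) := sq_nonneg _
      linarith
  exact ⟨h1, fidelity_triangle hφ.1 (C.norm_history z) (C.norm_guiding z) h1
    (C.fidelity_history_guiding (by omega) z)⟩

/-! ### Norm bounds -/

theorem opNorm_mul_le_one {Q : Type} [Fintype Q] [DecidableEq Q] {A B : QOp Q}
    (hA : opNorm A ≤ 1) (hB : opNorm B ≤ 1) : opNorm (A * B) ≤ 1 :=
  (opNorm_mul_le A B).trans (mul_le_one₀ hA (opNorm_nonneg B) hB)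

theorem opNorm_sum_le_card {Q : Type} {ι : Type*} [Fintype Q] [DecidableEq Q] (s : Finset ι) (A : ι → QOp Q)
    {c : ℝ} (h : ∀ i ∈ s, opNorm (A i) ≤ c) : opNorm (∑ i ∈ s, A i) ≤ s.card * c := by
  refine (opNorm_sum_le s A).trans ((Finset.sum_le_sum h).trans_eq ?_)
  rw [Finset.sum_const, nsmul_eq_mul]

theorem opNorm_HIn_le (K : ℕ) (z : Fin N → Bool) : opNorm (HIn K z) ≤ N := by
  refine (opNorm_sum_le_card _ _ (c := 1) fun i _ =>
    opNorm_mul_le_one (opNorm_ketbra_le _ _ _) (opNorm_clockKB_le _ _ _ _ _)).trans_eq ?_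
  simp

theorem opNorm_HOut_le (K : ℕ) (out : Fin N) : opNorm (HOut K out) ≤ 1 :=
  opNorm_mul_le_one (opNorm_ketbra_le _ _ _) (opNorm_clockKB_le _ _ _ _ _)

theorem opNorm_HClock_le (N K : ℕ) : opNorm (HClock N K) ≤ K := by
  refine (opNorm_sum_le_card _ _ (c := 1) fun i _ =>
    opNorm_mul_le_one (opNorm_clockKB_le _ _ _ _ _) (opNorm_clockKB_le _ _ _ _ _)).trans ?_
  simp

theorem opNorm_clock10_le (N K t : ℕ) : opNorm (clock10 N K t) ≤ 1 :=
  opNorm_mul_le_one (opNorm_clockKB_le _ _ _ _ _) (opNorm_clockKB_le _ _ _ _ _)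

theorem opNorm_clockX_le (N K t : ℕ) : opNorm (clockX N K t) ≤ 2 :=
  (opNorm_add_le _ _).trans (by
    linarith [opNorm_clockKB_le N K t true false, opNorm_clockKB_le N K t false true])

theorem opNorm_clockXX_le (N K t : ℕ) : opNorm (clockXX N K t) ≤ 2 :=
  (opNorm_add_le _ _).trans (by
    linarith [opNorm_mul_le_one (opNorm_clockKB_le N K t true false)
      (opNorm_clockKB_le N K (t + 1) true false),
      opNorm_mul_le_one (opNorm_clockKB_le N K t false true)
      (opNorm_clockKB_le N K (t + 1) false true)])

theorem opNorm_idled_le (K t : ℕ) : opNorm (C.idled M K t) ≤ 1 := by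
  refine opNorm_le_one_of_isometry _ ?_
  rw [idled_eq_tens, tens_conjTranspose, tens_mul, regGate_unitary, Matrix.conjTranspose_one,
    mul_one, tens_one_one]

theorem opNorm_HPropAt_le (t : ℕ) : opNorm (C.HPropAt M t) ≤ 2 := by
  have h1 : opNorm (if t = C.T + M then clockKB N (C.T + M) (C.T + M) true true
      else clock10 N (C.T + M) t) ≤ 1 := by
    split_ifs
    · exact opNorm_clockKB_le _ _ _ _ _
    · exact opNorm_clock10_le _ _ _
  have h2 : opNorm (if t = 1 then clockKB N (C.T + M) 1 false false
      else clock10 N (C.T + M) (t - 1)) ≤ 1 := by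
    split_ifs
    · exact opNorm_clockKB_le _ _ _ _ _
    · exact opNorm_clock10_le _ _ _
  have h3 := opNorm_mul_le_one (C.opNorm_idled_le (M := M) (C.T + M) t)
    (opNorm_clockKB_le N (C.T + M) t true false)
  have h4 := opNorm_mul_le_one
    ((opNorm_conjTranspose _).trans_le (C.opNorm_idled_le (M := M) (C.T + M) t))
    (opNorm_clockKB_le N (C.T + M) t false true)
  rw [HPropAt, opNorm_smul]
  have h5 := (opNorm_sub_le _ _).trans (add_le_add ((opNorm_sub_le _ _).trans
    (add_le_add ((opNorm_add_le _ _).trans (add_le_add h1 h2)) h3)) h4)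
  refine (mul_le_mul_of_nonneg_left h5 (norm_nonneg _)).trans ?_
  norm_num

theorem opNorm_HProp1_le : opNorm (C.HProp1 M) ≤ 2 * ((C.T + M : ℕ) : ℝ) := by
  refine (opNorm_sum_le_card _ _ fun t _ => C.opNorm_HPropAt_le t).trans ?_
  rw [mul_comm]
  gcongr
  exact (Finset.card_le_card Finset.sdiff_subset).trans (by simp)

theorem opNorm_HQubitAt_le (t : ℕ) : opNorm (C.HQubitAt M t) ≤ 6 := by
  rw [HQubitAt]
  split
  · rw [opNorm_zero]; norm_num
  · rename_i f s _ _
    have hk := fun (q : Fin N) (a : Bool) =>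
      opNorm_ketbra_le (Sum.inl q : Qubits N (C.T + M)) a a
    have hk2 : ∀ (q : Fin N) (a : Bool),
        opNorm ((-2 : ℂ) • ketbra (Sum.inl q : Qubits N (C.T + M)) a a) ≤ 2 := by
      intro q a
      rw [opNorm_smul]
      have := hk q a
      norm_num
      linarith
    have h5 := (opNorm_add_le _ _).trans (add_le_add ((opNorm_add_le _ _).trans
      (add_le_add ((opNorm_add_le _ _).trans (add_le_add (hk2 f false) (hk2 s false)))
        (hk f true))) (hk s true))
    rw [smul_mul_assoc, opNorm_smul]
    refine (mul_le_mul_of_nonneg_left ((opNorm_mul_le _ _).trans (mul_le_mul h5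
      (opNorm_clockX_le _ _ _) (opNorm_nonneg _) (by norm_num))) (norm_nonneg _)).trans ?_
    norm_num

theorem opNorm_HTimeAt_le (t : ℕ) : opNorm (C.HTimeAt M t) ≤ 4 := by
  have hP := opNorm_clock10_le N (C.T + M)
  have hX := opNorm_clockX_le N (C.T + M)
  have h6 : ∀ t, opNorm ((6 : ℂ) • clock10 N (C.T + M) t) ≤ 6 := by
    intro t
    rw [opNorm_smul]
    have := hP t
    norm_num
    linarith
  have hY : ∀ t, opNorm ((2 : ℂ) • clockXX N (C.T + M) t) ≤ 4 := by
    intro t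
    rw [opNorm_smul]
    have := opNorm_clockXX_le N (C.T + M) t
    norm_num
    linarith
  have hadd : ∀ {A B : QOp (Qubits N (C.T + M))} {a b : ℝ}, opNorm A ≤ a → opNorm B ≤ b →
      opNorm (A + B) ≤ a + b := fun ha hb => (opNorm_add_le _ _).trans (add_le_add ha hb)
  rw [HTimeAt, opNorm_smul]
  have h := hadd (hadd (hadd (hadd (hadd (hadd (hadd (hadd (hadd (hadd (hadd (hP t) (h6 (t + 1)))
    (hP (t + 2))) (hY (t + 1))) (hX (t + 1))) (hX (t + 2))) (hP (t - 3))) (h6 (t - 2)))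
    (hP (t - 1))) (hY (t - 2))) (hX (t - 2))) (hX (t - 1))
  refine (mul_le_mul_of_nonneg_left h (norm_nonneg _)).trans ?_
  -- The norms of the twelve summands add up to at most 32, and 32/8 = 4.
  norm_num

theorem opNorm_HProp2_le : opNorm (C.HProp2 M) ≤ 10 * ((C.T + M : ℕ) : ℝ) := by
  refine (opNorm_sum_le_card _ _ (c := 10) fun t _ => ?_).trans ?_
  · refine (opNorm_add_le _ _).trans ?_
    linarith [C.opNorm_HQubitAt_le (M := M) t, C.opNorm_HTimeAt_le (M := M) t]
  · rw [mul_comm]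
    gcongr
    have : C.czTimes M ⊆ Finset.Icc 1 (C.T + M) := fun t ht => by
      obtain ⟨_, _, _, _, _, _, _, _, _, b1, b2, _⟩ := C.czTimes_spec ht
      rw [Finset.mem_Icc]
      omega
    exact (Finset.card_le_card this).trans (by simp)

end RegularCircuit

/-! ### Polynomial choices of the parameters -/

namespace ParameterChoice

open Polynomial

/-- The number of idling steps. -/
def idle (size q : ℕ[X]) : ℕ[X] := 4 * q * size + size + 2

/-- The inverse fidelity loss of the history state. -/
def gap (q : ℕ[X]) : ℕ[X] := 4 * q

/-- A bound for the number of clock qubits. -/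
def clock (size q : ℕ[X]) : ℕ[X] := size + idle size q

/-- The couplings are defined from the weakest to the strongest, so each condition involves only
quantities already bounded; the norm of the output term is at most 1. -/
def jin (size q : ℕ[X]) : ℕ[X] := couplingPoly.comp (clock size q) * gap q

/-- A bound for the norm of the output and input terms. -/
def normIn (size q : ℕ[X]) : ℕ[X] := 1 + jin size q * size

def j2 (size q : ℕ[X]) : ℕ[X] := couplingPoly.comp (normIn size q * size) * gap q

/-- A bound for the norm of the output, input and controlled-`Z` terms. -/
def norm2 (size q : ℕ[X]) : ℕ[X] := normIn size q + j2 size q * (10 * clock size q)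

def j1 (size q : ℕ[X]) : ℕ[X] := couplingPoly.comp (norm2 size q * idle size q) * gap q

/-- A bound for the norm of the sum of all terms except the clock term. -/
def norm1 (size q : ℕ[X]) : ℕ[X] := norm2 size q + j1 size q * (2 * clock size q)

def jclock (size q : ℕ[X]) : ℕ[X] := couplingPoly.comp (norm1 size q) * gap q

/-- Serves two purposes: the first three summands bound the norm of the Hamiltonian, and the last
two give the support size `M + 1`. -/
def bound (size q : ℕ[X]) : ℕ[X] :=
  norm1 size q + jclock size q * clock size q + clock size q + idle size q + 1

/-- The coupling polynomial is monotone on nonnegative reals, so an upper bound for a norm suffices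
in a coupling condition. -/
theorem coupling_le {x g : ℝ} {P : ℕ[X]} {n : ℕ} (hx : 0 ≤ x) (hg : 0 ≤ g)
    (h : x ≤ ((P.eval n : ℕ) : ℝ)) :
    (couplingPoly.map (Nat.castRingHom ℝ)).eval x * g ≤
      (((couplingPoly.comp P).eval n : ℕ) : ℝ) * g := by
  have e : (((couplingPoly.comp P).eval n : ℕ) : ℝ) = 1000 * (((P.eval n : ℕ) : ℝ) + 1) ^ 4 := by
    simp [couplingPoly]
  rw [e, eval_couplingPoly]
  gcongr

end ParameterChoice

namespace RegularCircuit

open ParameterChoice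

variable {N : ℕ} (C : RegularCircuit N) {M : ℕ}

theorem opNorm_bounds {σ κ : ℝ} (hN : (N : ℝ) ≤ σ) (hκ : ((C.T + M : ℕ) : ℝ) ≤ κ)
    (z : Fin N → Bool) (out : Fin N) {Jin J2 J1 Jc : ℝ} (hin : 0 ≤ Jin) (h2 : 0 ≤ J2)
    (h1 : 0 ≤ J1) (hc : 0 ≤ Jc) :
    opNorm (HOut (C.T + M) out + Jin • HIn (C.T + M) z) ≤ 1 + Jin * σ ∧
    opNorm (HOut (C.T + M) out + Jin • HIn (C.T + M) z + J2 • C.HProp2 M) ≤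
      1 + Jin * σ + J2 * (10 * κ) ∧
    opNorm (HOut (C.T + M) out + Jin • HIn (C.T + M) z + J2 • C.HProp2 M + J1 • C.HProp1 M) ≤
      1 + Jin * σ + J2 * (10 * κ) + J1 * (2 * κ) ∧
    opNorm (C.hamiltonian M z out ⟨Jin, Jc, J1, J2⟩) ≤
      1 + Jin * σ + J2 * (10 * κ) + J1 * (2 * κ) + Jc * κ + κ := by
  have e1 : opNorm (Jin • HIn (C.T + M) z) ≤ Jin * σ := by
    rw [opNorm_real_smul, abs_of_nonneg hin]
    gcongr
    exact (opNorm_HIn_le _ z).trans hN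
  have e2 : opNorm (J2 • C.HProp2 M) ≤ J2 * (10 * κ) := by
    rw [opNorm_real_smul, abs_of_nonneg h2]
    gcongr
    exact C.opNorm_HProp2_le.trans (by linarith)
  have e3 : opNorm (J1 • C.HProp1 M) ≤ J1 * (2 * κ) := by
    rw [opNorm_real_smul, abs_of_nonneg h1]
    gcongr
    exact C.opNorm_HProp1_le.trans (by linarith)
  have e4 : opNorm (Jc • HClock N (C.T + M)) ≤ Jc * κ := by
    rw [opNorm_real_smul, abs_of_nonneg hc]
    gcongr
    exact (opNorm_HClock_le _ _).trans hκ
  have e0 := opNorm_HOut_le (C.T + M) out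
  have e5 : opNorm (((C.T + M : ℕ) : ℝ) • HOut (C.T + M) out) ≤ κ := by
    rw [opNorm_real_smul, abs_of_nonneg (Nat.cast_nonneg _)]
    nlinarith [opNorm_nonneg (HOut (C.T + M) out), (Nat.cast_nonneg (C.T + M) : (0 : ℝ) ≤ _)]
  have b2 := (opNorm_add_le _ _).trans (add_le_add e0 e1)
  have b1 := (opNorm_add_le _ _).trans (add_le_add b2 e2)
  have b0 := (opNorm_add_le _ _).trans (add_le_add b1 e3)
  refine ⟨b2, b1, b0, ?_⟩
  rw [hamiltonian]
  have := (opNorm_add_le _ _).trans (add_le_add ((opNorm_add_le _ _).trans (add_le_add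
    ((opNorm_add_le _ _).trans (add_le_add ((opNorm_add_le _ _).trans (add_le_add e1 e4)) e3))
    e2)) e5)
  linarith

/-- Each square root is at most that of 1/(4q), and doubling before squaring restores the factor 4.
This explains the 4 in `idle` and `gap`. -/
theorem sqrt_add_sqrt_sq_le {T M q : ℝ} (hM : 0 < M) (hq : 0 < q)
    (h : 4 * q * T ≤ M) : (Real.sqrt (T / M) + Real.sqrt (1 / (4 * q))) ^ 2 ≤ 1 / q := by
  have h1 : T / M ≤ 1 / (4 * q) := by
    rw [div_le_div_iff₀ hM (by positivity)]
    linarith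
  have h2 := Real.sqrt_le_sqrt h1
  calc _ ≤ (Real.sqrt (1 / (4 * q)) + Real.sqrt (1 / (4 * q))) ^ 2 := by gcongr
    _ = 4 * Real.sqrt (1 / (4 * q)) ^ 2 := by ring
    _ = 1 / q := by
      rw [Real.sq_sqrt (by positivity)]
      field_simp

theorem couplingConditions_choice {size q : Polynomial ℕ} {n : ℕ} (hN : N ≤ size.eval n)
    (hT : C.T ≤ size.eval n) (hM : M = (idle size q).eval n) (z : Fin N → Bool) (out : Fin N)
    {J : Couplings} (hJ : J = { Jin := (((jin size q).eval n : ℕ) : ℝ),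
                                Jclock := (((jclock size q).eval n : ℕ) : ℝ),
                                J1 := (((j1 size q).eval n : ℕ) : ℝ),
                                J2 := (((j2 size q).eval n : ℕ) : ℝ) }) :
    C.CouplingConditions M (couplingPoly.map (Nat.castRingHom ℝ))
      (couplingPoly.map (Nat.castRingHom ℝ)) (couplingPoly.map (Nat.castRingHom ℝ))
      (couplingPoly.map (Nat.castRingHom ℝ)) z out J (((gap q).eval n : ℕ) : ℝ) ∧
    opNorm (C.hamiltonian M z out J) ≤ (((bound size q).eval n : ℕ) : ℝ) := by
  have hκ : ((C.T + M : ℕ) : ℝ) ≤ (((clock size q).eval n : ℕ) : ℝ) := by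
    rw [clock, Polynomial.eval_add, ← hM]
    exact_mod_cast Nat.add_le_add_right hT M
  have hN' : (N : ℝ) ≤ ((size.eval n : ℕ) : ℝ) := by exact_mod_cast hN
  have hT' : (C.T : ℝ) ≤ ((size.eval n : ℕ) : ℝ) := by exact_mod_cast hT
  subst hJ
  obtain ⟨b2, b1, b0, b⟩ := C.opNorm_bounds hN' hκ z out
    (Jin := (((jin size q).eval n : ℕ) : ℝ)) (J2 := (((j2 size q).eval n : ℕ) : ℝ))
    (J1 := (((j1 size q).eval n : ℕ) : ℝ)) (Jc := (((jclock size q).eval n : ℕ) : ℝ))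
    (Nat.cast_nonneg _) (Nat.cast_nonneg _) (Nat.cast_nonneg _) (Nat.cast_nonneg _)
  have hn2 : 1 + (((jin size q).eval n : ℕ) : ℝ) * ((size.eval n : ℕ) : ℝ) =
      (((normIn size q).eval n : ℕ) : ℝ) := by simp [normIn]
  rw [hn2] at b2 b1 b0 b
  have hn1 : (((normIn size q).eval n : ℕ) : ℝ) + (((j2 size q).eval n : ℕ) : ℝ) *
      (10 * (((clock size q).eval n : ℕ) : ℝ)) = (((norm2 size q).eval n : ℕ) : ℝ) := by
    simp [norm2]
  rw [hn1] at b1 b0 b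
  have hn0 : (((norm2 size q).eval n : ℕ) : ℝ) + (((j1 size q).eval n : ℕ) : ℝ) *
      (2 * (((clock size q).eval n : ℕ) : ℝ)) = (((norm1 size q).eval n : ℕ) : ℝ) := by
    simp [norm1]
  rw [hn0] at b0 b
  have hmul : ∀ P : Polynomial ℕ, (((P * gap q).eval n : ℕ) : ℝ) =
      ((P.eval n : ℕ) : ℝ) * (((gap q).eval n : ℕ) : ℝ) := by intro P; simp
  refine ⟨⟨?_, ?_, ?_, ?_⟩, ?_⟩
  · refine (coupling_le (opNorm_nonneg _) (Nat.cast_nonneg _) b0).trans_eq ?_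
    exact (hmul _).symm
  · refine (coupling_le (P := norm2 size q * idle size q) (n := n)
      (mul_nonneg (opNorm_nonneg _) (Nat.cast_nonneg _)) (Nat.cast_nonneg _) ?_).trans_eq
      (hmul _).symm
    rw [Polynomial.eval_mul, Nat.cast_mul, ← hM]
    gcongr
  · refine (coupling_le (P := normIn size q * size) (n := n)
      (mul_nonneg (opNorm_nonneg _) (Nat.cast_nonneg _)) (Nat.cast_nonneg _) ?_).trans_eq
      (hmul _).symm
    rw [Polynomial.eval_mul, Nat.cast_mul]
    gcongr
  · refine (coupling_le (P := clock size q) (n := n)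
      (mul_nonneg (opNorm_nonneg _) (Nat.cast_nonneg _)) (Nat.cast_nonneg _) ?_).trans_eq
      (hmul _).symm
    refine le_trans ?_ hκ
    exact mul_le_of_le_one_left (Nat.cast_nonneg _) (opNorm_HOut_le _ _)
  · refine b.trans ?_
    simp only [bound, Polynomial.eval_add, Polynomial.eval_mul, Polynomial.eval_one, Nat.cast_add,
      Nat.cast_mul, Nat.cast_one]
    have : (0 : ℝ) ≤ (((idle size q).eval n : ℕ) : ℝ) := Nat.cast_nonneg _
    linarith

end RegularCircuit

end

theorem mainTheorem7 :
    ∃ pclock p1 p2 pin : Polynomial ℝ,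
      -- fidelity bounds for every instance, whatever the acceptance probability
      (∀ (n r : ℕ) (hN : 0 < n + r) (x : Fin n → Bool) (C : RegularCircuit (n + r)) (M : ℕ)
          (J : Couplings) (Δ : ℝ),
        C.L < M → 0 < Δ →
        C.CouplingConditions M pclock p1 p2 pin (initial r x) ⟨0, hN⟩ J Δ →
        IsLocalHamiltonian 2 (C.hamiltonian M (initial r x) ⟨0, hN⟩ J) ∧
        IsSemiClassical (M + 1) (C.guiding M (initial r x)) ∧
        ∀ φ, IsGroundState (C.hamiltonian M (initial r x) ⟨0, hN⟩ J) φ →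
          1 - 1 / Δ ≤ fidelity φ (C.history M (initial r x)) ∧
          1 - (Real.sqrt ((C.T : ℝ) / M) + Real.sqrt (1 / Δ)) ^ 2 ≤
            fidelity φ (C.guiding M (initial r x))) ∧
      -- polynomial choices of all parameters give fidelity `1 - 1 / q(n)`
      (∀ size q : Polynomial ℕ, ∃ idle gap bound jin jclock j1 j2 : Polynomial ℕ,
        ∀ (n r : ℕ) (hN : 0 < n + r) (x : Fin n → Bool) (C : RegularCircuit (n + r)),
        n + r ≤ size.eval n → C.T ≤ size.eval n → 0 < q.eval n →
        ∀ (M : ℕ) (J : Couplings), M = idle.eval n →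
          J = { Jin := ((jin.eval n : ℕ) : ℝ), Jclock := ((jclock.eval n : ℕ) : ℝ),
                J1 := ((j1.eval n : ℕ) : ℝ), J2 := ((j2.eval n : ℕ) : ℝ) } →
          C.L < M ∧ 0 < gap.eval n ∧
          C.CouplingConditions M pclock p1 p2 pin (initial r x) ⟨0, hN⟩ J ((gap.eval n : ℕ) : ℝ) ∧
          opNorm (C.hamiltonian M (initial r x) ⟨0, hN⟩ J) ≤ ((bound.eval n : ℕ) : ℝ) ∧
          IsSemiClassical (bound.eval n) (C.guiding M (initial r x)) ∧
          ∀ φ, IsGroundState (C.hamiltonian M (initial r x) ⟨0, hN⟩ J) φ →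
            1 - 1 / ((gap.eval n : ℕ) : ℝ) ≤ fidelity φ (C.history M (initial r x)) ∧
            1 - 1 / ((q.eval n : ℕ) : ℝ) ≤ fidelity φ (C.guiding M (initial r x))) := by
  refine ⟨couplingPoly.map (Nat.castRingHom ℝ), couplingPoly.map (Nat.castRingHom ℝ),
    couplingPoly.map (Nat.castRingHom ℝ), couplingPoly.map (Nat.castRingHom ℝ), ?_, ?_⟩
  · intro n r hN x C M J Δ hM hΔ hJ
    exact ⟨C.isLocalHamiltonian_hamiltonian M hN _ _ J, C.isSemiClassical_guiding _,
      fun φ hφ => C.fidelity_bounds hN _ _ J hM hΔ hJ hφ⟩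
  · intro size q
    refine ⟨ParameterChoice.idle size q, ParameterChoice.gap q, ParameterChoice.bound size q,
      ParameterChoice.jin size q, ParameterChoice.jclock size q, ParameterChoice.j1 size q,
      ParameterChoice.j2 size q, ?_⟩
    intro n r hN x C hn hT hq M J hM hJ
    have hidle : (ParameterChoice.idle size q).eval n = 4 * q.eval n * size.eval n + size.eval n + 2 := by
      simp [ParameterChoice.idle]
    have hgap : (ParameterChoice.gap q).eval n = 4 * q.eval n := by simp [ParameterChoice.gap]
    -- Since `C.L ≤ C.T + 1`, the summand `size + 2` of `idle` is enough.
    have hL : C.L < M := by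
      have h : C.L ≤ (C.T₂ + 1) * C.L := Nat.le_mul_of_pos_left _ (by omega)
      have h' : C.T = (C.T₂ + 1) * C.L - 1 := rfl
      have h'' : 0 ≤ 4 * q.eval n * size.eval n := Nat.zero_le _
      omega
    have hg : 0 < (ParameterChoice.gap q).eval n := by omega
    obtain ⟨hc, hb⟩ := C.couplingConditions_choice hn hT hM (initial r x) ⟨0, hN⟩ hJ
    refine ⟨hL, hg, hc, hb, (C.isSemiClassical_guiding _).mono ?_, fun φ hφ => ?_⟩
    · rw [ParameterChoice.bound, Polynomial.eval_add, Polynomial.eval_add, Polynomial.eval_one, ← hM]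
      omega
    · have h := C.fidelity_bounds hN _ _ J hL (by exact_mod_cast hg) hc hφ
      refine ⟨h.1, le_trans ?_ h.2⟩
      have hMq : 4 * ((q.eval n : ℕ) : ℝ) * (C.T : ℝ) ≤ (M : ℝ) := by
        have : 4 * q.eval n * C.T ≤ 4 * q.eval n * size.eval n := Nat.mul_le_mul_left _ hT
        have h' : 4 * q.eval n * C.T ≤ M := by omega
        exact_mod_cast h'
      have := RegularCircuit.sqrt_add_sqrt_sq_le (T := C.T) (M := M) (q := ((q.eval n : ℕ) : ℝ))
        (by exact_mod_cast (by omega : 0 < M)) (by exact_mod_cast hq) hMq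
      rw [hgap]
      push_cast
      linarith
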